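/- Let $\eta\in\mathbb R$, $n\ge 0$, and let $BUC_\eta$ be the space of functions $\varphi:(-\infty,0]\to\mathbb C^n$ such that $\theta\mapsto e^{\eta\theta}\varphi(\theta)$ is bounded and uniformly continuous, with norm $\|\varphi\|_\eta=\sup_{\theta\le 0}e^{\eta\theta}\|\varphi(\theta)\|$. Let $\widehat L:BUC_\eta\to\mathbb C^n$ be bounded and $\mathbb C$-linear (for instance the complexification of a bounded linear map defined on the $\mathbb R^n$-valued functions of this kind). On $X=\mathbb C^n\times BUC_\eta$ let $$A(0,\varphi)=(-\varphi'(0),\varphi'),\quad D(A)=\{0\}\times BUC_\eta^1,\qquad L(0,\varphi)=(\widehat L\varphi,0),\quad D(L)=\overline{D(A)}=\{0\}\times BUC_\eta ,$$ where $BUC^1_\eta$ is the set of $C^1$ functions $\varphi$ with $\varphi,\varphi'\in BUC_\eta$. Let $(A+L)_0$ be the part of $A+L$ in $\overline{D(A)}$, let $\omega_{0,ess}((A+L)_0)=\lim_{t\to\infty}t^{-1}\ln\|T(t)\|_{ess}$ be the essential growth bound of the strongly continuous semigroup $T$ that it generates, where $\|T(t)\|_{ess}$ is the Kuratowski (ball)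 measure of noncompactness of the image of the closed unit ball, and for $\mathrm{Re}\,\lambda>-\eta$ put $$\Delta(\lambda)=\lambda I-\widehat L(e^{\lambda\cdot}I)\in M_n(\mathbb C).$$ Let $\lambda_0\in\sigma(A+L)$ satisfy $\mathrm{Re}\,\lambda_0>\omega_{0,ess}((A+L)_0)$ or $\mathrm{Re}\,\lambda_0>-\eta$. Then $\mathrm{Re}\,\lambda_0>-\eta$, and $\lambda_0$ has a punctured neighbourhood contained in $\rho(A+L)$ on which $\det\Delta(\lambda)\ne0$. There is an integer $k_0\ge1$ such that $\lambda_0$ is a pole of order $k_0$ of both the resolvent and $\Delta(\cdot)^{-1}$: near $\lambda_0$, $$(\lambda I-(A+L))^{-1}=\sum_{m\ge-k_0}(\lambda-\lambda_0)^mB_m^{\lambda_0},\qquad \Delta(\lambda)^{-1}=\sum_{m\ge-k_0}(\lambda-\lambda_0)^m\Delta_m,\qquad B_{-k_0}^{\lambda_0}\neq0,\quad \Delta_{-k_0}\ne0,$$ with convergence in $\mathcal L(X)$ and $M_n(\mathbb C)$ respectively. Moreover $\Delta_{-k_0}=\lim_{\lambda\to\lambda_0}(\lambda-\lambda_0)^{k_0}\Delta(\lambda)^{-1}$,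 and $k_0$ is the only integer $k$ for which $(\lambda-\lambda_0)^{k}\Delta(\lambda)^{-1}$ has a nonzero limit in $M_n(\mathbb C)$ as $\lambda\to\lambda_0$; and $$\Delta_{-j}=\lim_{\lambda\to\lambda_0}\frac1{(k_0-j)!}\frac{d^{k_0-j}}{d\lambda^{k_0-j}}\Big((\lambda-\lambda_0)^{k_0}\Delta(\lambda)^{-1}\Big),\qquad j=1,\dots,k_0 .$$ The operator $B^{\lambda_0}_{-1}$ is a projector whose range is the generalized eigenspace $\bigcup_{m}\ker(\lambda_0I-(A+L))^m$, and for all $(\alpha,\varphi)\in X$ $$B_{-1}^{\lambda_0}\begin{pmatrix}\alpha\\ \varphi\end{pmatrix}=\begin{pmatrix}0\\ \sum_{j=0}^{k_0-1}\frac1{j!}\Delta_{-1-j}L_j^2(\lambda_0)\begin{pmatrix}\alpha\\ \varphi\end{pmatrix}\end{pmatrix}.$$ Here, for $\mathrm{Re}\,\lambda>-\eta$, $$b(\lambda)=\alpha+\varphi(0)+\widehat L\Big(\int_\cdot^0e^{\lambda(\cdot-s)}\varphi(s)\,ds\Big)\in\mathbb C^n,\qquad \Big(L_0^2(\lambda)\begin{pmatrix}\alpha\\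 \varphi\end{pmatrix}\Big)(\theta)=e^{\lambda\theta}b(\lambda),\qquad L_j^2(\lambda)\begin{pmatrix}\alpha\\ \varphi\end{pmatrix}=\frac{d^j}{d\lambda^j}\Big[L_0^2(\lambda)\begin{pmatrix}\alpha\\ \varphi\end{pmatrix}\Big].$$ The $BUC_\eta$-valued function $L_0^2(\cdot)(\alpha,\varphi)$ and the function $b$ are holomorphic on $\{\mathrm{Re}\,\lambda>-\eta\}$, and there $$\Big(L_j^2(\lambda)\begin{pmatrix}\alpha\\ \varphi\end{pmatrix}\Big)(\theta)=\sum_{k=0}^j\binom jk\theta^ke^{\lambda\theta}\,b^{(j-k)}(\lambda)\quad(j\ge0),\qquad b^{(i)}(\lambda)=\widehat L\Big(\int_\cdot^0(\cdot-s)^ie^{\lambda(\cdot-s)}\varphi(s)\,ds\Big)\quad(i\ge1).$$ -/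

import Mathlib

open Set Filter Topology
open scoped NNReal ENNReal

noncomputable section

namespace DelayEq

/-! ### Unbounded operators, resolvents, Laurent expansions, semigroups -/

section Abstract

variable {X : Type*} [NormedAddCommGroup X] [NormedSpace ℂ X]

/-- `R` is the bounded inverse of `z I - B : D(B) → X`. -/
def IsResolventAt (B : X →ₗ.[ℂ] X) (z : ℂ) (R : X →L[ℂ] X) : Prop :=
  (∀ x : X, (R x, z • R x - x) ∈ B.graph) ∧ ∀ x : B.domain, R (z • (x : X) - B x) = x

/-- The resolvent set `ρ(B)`. -/
def resolventSet (B : X →ₗ.[ℂ] X) : Set ℂ := {z | ∃ R, IsResolventAt B z R}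

/-- The spectrum `σ(B)`. -/
def spectrum (B : X →ₗ.[ℂ] X) : Set ℂ := (resolventSet B)ᶜ

open Classical in
/-- The resolvent `(z I - B)⁻¹ ∈ L(X)` for `z ∈ ρ(B)` (and `0` for `z ∈ σ(B)`). -/
def resolvent (B : X →ₗ.[ℂ] X) (z : ℂ) : X →L[ℂ] X :=
  if h : ∃ R, IsResolventAt B z R then h.choose else 0

/-- The generalized eigenspace `⋃ₘ ker (z I - B)ᵐ`: the `x` admitting a chain
`x = y 0, y 1, …, y m = 0` with `y i ∈ D(B)` and `y (i + 1) = (z I - B) (y i)` for `i < m`. -/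
def generalizedEigenspace (B : X →ₗ.[ℂ] X) (z : ℂ) : Set X :=
  {x | ∃ (m : ℕ) (y : ℕ → X), y 0 = x ∧ y m = 0 ∧
    ∀ i < m, (y i, z • y i - y (i + 1)) ∈ B.graph}

/-- On a punctured neighbourhood of `z₀`, `f z = ∑_{j ≥ -k} (z - z₀)ʲ a j`; here `a j = 0` for
`j < -k`. -/
def HasLaurentExpansionAt {F : Type*} [NormedAddCommGroup F] [NormedSpace ℂ F]
    (f : ℂ → F) (z₀ : ℂ) (k : ℕ) (a : ℤ → F) : Prop :=
  (∀ j : ℤ, j < -(k : ℤ) → a j = 0) ∧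
  ∀ᶠ z in 𝓝[≠] z₀,
    HasSum (fun m : ℕ => (z - z₀) ^ ((m : ℤ) - k) • a ((m : ℤ) - k)) (f z)

/-- The part of `B` in the closure of its domain: its graph is the set of `(x, y)` in
`D(B)‾ × D(B)‾` with `x ∈ D(B)` and `B x = y`. -/
def partInClosure (B : X →ₗ.[ℂ] X) :
    B.domain.topologicalClosure →ₗ.[ℂ] B.domain.topologicalClosure :=
  (B.graph.comap
    (B.domain.topologicalClosure.subtype.prodMap B.domain.topologicalClosure.subtype)).toLinearPMap

/-- Strongly continuous semigroups of bounded operators. -/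
structure IsC0Semigroup (T : ℝ≥0 → X →L[ℂ] X) : Prop where
  map_zero : T 0 = ContinuousLinearMap.id ℂ X
  map_add : ∀ s t, T (s + t) = (T s).comp (T t)
  continuous : ∀ x, Continuous fun t => T t x

/-- `B` is the infinitesimal generator of `T`. -/
def IsGenerator (B : X →ₗ.[ℂ] X) (T : ℝ≥0 → X →L[ℂ] X) : Prop :=
  ∀ x y : X, (x, y) ∈ B.graph ↔
    Tendsto (fun h : ℝ≥0 => (((h : ℝ) : ℂ))⁻¹ • (T h x - x)) (𝓝[>] 0) (𝓝 y)

/-- Kuratowski measure of noncompactness (by balls) of a bounded set. -/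
def kuratowski (S : Set X) : ℝ :=
  sInf {ε : ℝ | 0 < ε ∧ ∃ c : Set X, c.Finite ∧ S ⊆ ⋃ x ∈ c, Metric.closedBall x ε}

/-- Essential norm of a bounded operator. -/
def essNorm (T : X →L[ℂ] X) : ℝ := kuratowski (T '' Metric.closedBall 0 1)

/-- Essential growth rate `lim_{t → ∞} ln ‖T(t)‖_ess / t ∈ [-∞, ∞]` of a semigroup
(by submultiplicativity of the essential norm the upper limit is a limit). -/
def essGrowthRate (T : ℝ≥0 → X →L[ℂ] X) : EReal :=
  limsup (fun t : ℝ≥0 => ENNReal.log (ENNReal.ofReal (essNorm (T t))) / ((t : ℝ) : EReal)) atTop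

/-- Essential growth bound `ω_{0,ess}(B)` of the generator `B` of a strongly continuous
semigroup `T` (the generator determines `T`; the infimum is `⊤` if `B` is not a generator). -/
def essGrowthBound (B : X →ₗ.[ℂ] X) : EReal :=
  ⨅ (T : ℝ≥0 → X →L[ℂ] X) (_ : IsC0Semigroup T) (_ : IsGenerator B T), essGrowthRate T

end Abstract

/-! ### The phase space -/

/-- `ℂⁿ` with its Euclidean norm. -/
abbrev Cn (n : ℕ) : Type := EuclideanSpace ℂ (Fin n)

/-- The functions `φ : (-∞, 0] → ℂⁿ` for which `θ ↦ e^{ηθ} φ(θ)` is bounded and uniformly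
continuous (in particular `φ` is continuous). -/
def bucSubmodule (η : ℝ) (n : ℕ) : Submodule ℂ (Iic (0 : ℝ) → Cn n) where
  carrier := {φ | UniformContinuous (fun θ : Iic (0 : ℝ) => Real.exp (η * θ) • φ θ) ∧
    ∃ C : ℝ, ∀ θ : Iic (0 : ℝ), Real.exp (η * θ) * ‖φ θ‖ ≤ C}
  zero_mem' := by
    refine ⟨?_, 0, ?_⟩
    · simpa using uniformContinuous_const
    · simp
  add_mem' := by
    rintro φ ψ ⟨h1, C, hC⟩ ⟨h2, D, hD⟩
    refine ⟨?_, C + D, fun θ => ?_⟩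
    · simpa [smul_add] using h1.add h2
    · have h := norm_add_le (φ θ) (ψ θ)
      have h' := mul_le_mul_of_nonneg_left h (Real.exp_pos (η * θ)).le
      have := hC θ
      have := hD θ
      simp only [Pi.add_apply]
      linarith
  smul_mem' := by
    rintro c φ ⟨h1, C, hC⟩
    refine ⟨?_, ‖c‖ * C, fun θ => ?_⟩
    · have h : (fun θ : Iic (0 : ℝ) => Real.exp (η * θ) • (c • φ) θ) =
          fun θ : Iic (0 : ℝ) => c • (Real.exp (η * θ) • φ θ) := by
        funext θ
        rw [Pi.smul_apply, smul_comm]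
      rw [h]
      exact h1.const_smul c
    · have h := mul_le_mul_of_nonneg_left (hC θ) (norm_nonneg c)
      simp only [Pi.smul_apply, norm_smul]
      linarith

/-- The space `BUC_η((-∞, 0], ℂⁿ)`. -/
def BUC (η : ℝ) (n : ℕ) : Type := bucSubmodule η n

namespace BUC

variable {η : ℝ} {n : ℕ}

instance : AddCommGroup (BUC η n) := inferInstanceAs (AddCommGroup (bucSubmodule η n))

instance : Module ℂ (BUC η n) := inferInstanceAs (Module ℂ (bucSubmodule η n))

/-- The function underlying an element of `BUC_η`. -/
def toFun (φ : BUC η n) : Iic (0 : ℝ) → Cn n := (bucSubmodule η n).subtype φ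

instance : CoeFun (BUC η n) fun _ => Iic (0 : ℝ) → Cn n := ⟨toFun⟩

/-- An element of `BUC_η` from a function in it. -/
def ofMem (f : Iic (0 : ℝ) → Cn n) (h : f ∈ bucSubmodule η n) : BUC η n :=
  (⟨f, h⟩ : bucSubmodule η n)

@[simp] theorem ofMem_apply (f : Iic (0 : ℝ) → Cn n) (h : f ∈ bucSubmodule η n)
    (θ : Iic (0 : ℝ)) : ofMem f h θ = f θ := rfl

theorem mem (φ : BUC η n) : (φ : Iic (0 : ℝ) → Cn n) ∈ bucSubmodule η n := Subtype.property _

/-- `‖φ‖_η = sup_{θ ≤ 0} e^{ηθ} ‖φ(θ)‖`. -/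
instance : Norm (BUC η n) := ⟨fun φ => ⨆ θ : Iic (0 : ℝ), Real.exp (η * θ) * ‖φ θ‖⟩

theorem norm_def (φ : BUC η n) : ‖φ‖ = ⨆ θ : Iic (0 : ℝ), Real.exp (η * θ) * ‖φ θ‖ := rfl

theorem ext {φ ψ : BUC η n} (h : ∀ θ, φ θ = ψ θ) : φ = ψ := Subtype.ext (funext h)

@[simp] theorem add_apply (φ ψ : BUC η n) (θ : Iic (0 : ℝ)) : (φ + ψ) θ = φ θ + ψ θ := rfl

@[simp] theorem smul_apply (c : ℂ) (φ : BUC η n) (θ : Iic (0 : ℝ)) : (c • φ) θ = c • φ θ := rfl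

@[simp] theorem zero_apply (θ : Iic (0 : ℝ)) : (0 : BUC η n) θ = 0 := rfl

theorem bddAbove (φ : BUC η n) :
    BddAbove (range fun θ : Iic (0 : ℝ) => Real.exp (η * θ) * ‖φ θ‖) := by
  obtain ⟨C, hC⟩ := φ.mem.2
  exact ⟨C, by rintro _ ⟨θ, rfl⟩; exact hC θ⟩

theorem le_norm (φ : BUC η n) (θ : Iic (0 : ℝ)) : Real.exp (η * θ) * ‖φ θ‖ ≤ ‖φ‖ :=
  le_ciSup φ.bddAbove θ

instance : Nonempty (Iic (0 : ℝ)) := ⟨⟨0, self_mem_Iic⟩⟩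

theorem norm_le (φ : BUC η n) {C : ℝ} (h : ∀ θ : Iic (0 : ℝ), Real.exp (η * θ) * ‖φ θ‖ ≤ C) :
    ‖φ‖ ≤ C := ciSup_le h

theorem core : NormedSpace.Core ℂ (BUC η n) where
  norm_nonneg φ := Real.iSup_nonneg fun θ => by positivity
  norm_smul c φ := by
    rw [norm_def, norm_def, Real.mul_iSup_of_nonneg (norm_nonneg c)]
    congr 1
    funext θ
    rw [smul_apply, norm_smul]
    ring
  norm_triangle φ ψ := by
    refine norm_le _ fun θ => ?_
    have h := mul_le_mul_of_nonneg_left (norm_add_le (φ θ) (ψ θ)) (Real.exp_pos (η * θ)).le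
    have := φ.le_norm θ
    have := ψ.le_norm θ
    rw [add_apply]
    linarith
  norm_eq_zero_iff φ := by
    constructor
    · intro h
      refine ext fun θ => ?_
      have h1 := φ.le_norm θ
      rw [h] at h1
      have h2 : ‖φ θ‖ ≤ 0 := by
        by_contra! h3
        exact absurd h1 (not_le.2 (mul_pos (Real.exp_pos _) h3))
      simpa using h2
    · rintro rfl
      simp [norm_def]

instance : NormedAddCommGroup (BUC η n) := NormedAddCommGroup.ofCore core

instance : NormedSpace ℂ (BUC η n) := NormedSpace.ofCore core

/-- The extension of `φ` to `ℝ` by the constant `φ(0)` on `[0, ∞)`; only its values on `(-∞, 0]`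
are ever used. -/
def onReal (φ : BUC η n) : ℝ → Cn n := IicExtend φ

/-- The value `φ(0)`. -/
def at0 : BUC η n →ₗ[ℂ] Cn n where
  toFun φ := φ ⟨0, self_mem_Iic⟩
  map_add' _ _ := rfl
  map_smul' _ _ := rfl

open Classical in
/-- A function `(-∞, 0] → ℂⁿ` as an element of `BUC_η` (`0` if it does not belong to it). -/
def mk (f : Iic (0 : ℝ) → Cn n) : BUC η n :=
  if h : f ∈ bucSubmodule η n then ofMem f h else 0

theorem mk_apply {f : Iic (0 : ℝ) → Cn n} (h : f ∈ bucSubmodule η n) (θ : Iic (0 : ℝ)) :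
    (mk f : BUC η n) θ = f θ := by
  rw [mk, dif_pos h, ofMem_apply]

/-- The derivative of `φ` on `(-∞, 0]` (one-sided at `0`). -/
def derivFun (φ : BUC η n) (θ : Iic (0 : ℝ)) : Cn n := derivWithin φ.onReal (Iic 0) θ

theorem onReal_add (φ ψ : BUC η n) : (φ + ψ).onReal = φ.onReal + ψ.onReal := rfl

theorem onReal_smul (c : ℂ) (φ : BUC η n) : (c • φ).onReal = c • φ.onReal := rfl

theorem derivFun_add {φ ψ : BUC η n}
    (hφ : DifferentiableOn ℝ φ.onReal (Iic 0)) (hψ : DifferentiableOn ℝ ψ.onReal (Iic 0)) :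
    (φ + ψ).derivFun = φ.derivFun + ψ.derivFun := by
  funext θ
  simp only [derivFun, Pi.add_apply, onReal_add]
  exact derivWithin_add (hφ θ θ.2) (hψ θ θ.2)

theorem derivFun_smul (c : ℂ) {φ : BUC η n} (hφ : DifferentiableOn ℝ φ.onReal (Iic 0)) :
    (c • φ).derivFun = c • φ.derivFun := by
  funext θ
  simp only [derivFun, Pi.smul_apply, onReal_smul]
  exact derivWithin_const_smul c (hφ θ θ.2)

/-- `BUC¹_η`: the continuously differentiable `φ ∈ BUC_η` with `φ' ∈ BUC_η`
(elements of `BUC_η` being continuous). -/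
def C1 (η : ℝ) (n : ℕ) : Submodule ℂ (BUC η n) where
  carrier := {φ | DifferentiableOn ℝ φ.onReal (Iic 0) ∧ φ.derivFun ∈ bucSubmodule η n}
  zero_mem' := by
    have h : (0 : BUC η n).onReal = fun _ => 0 := rfl
    refine ⟨?_, ?_⟩
    · rw [h]
      exact differentiableOn_const _
    · have : (0 : BUC η n).derivFun = 0 := by
        funext θ
        simp [derivFun, h]
      rw [this]
      exact zero_mem _
  add_mem' := by
    rintro φ ψ ⟨h1, h2⟩ ⟨h3, h4⟩
    refine ⟨?_, ?_⟩
    · rw [onReal_add]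
      exact h1.add h3
    · rw [derivFun_add h1 h3]
      exact add_mem h2 h4
  smul_mem' := by
    rintro c φ ⟨h1, h2⟩
    refine ⟨?_, ?_⟩
    · rw [onReal_smul]
      exact h1.const_smul c
    · rw [derivFun_smul c h1]
      exact Submodule.smul_mem _ c h2

/-- `φ ↦ φ'` from `BUC¹_η` to `BUC_η`. -/
def deriv : C1 η n →ₗ[ℂ] BUC η n where
  toFun φ := ofMem (φ : BUC η n).derivFun φ.2.2
  map_add' φ ψ := ext (congrFun (derivFun_add φ.2.1 ψ.2.1))
  map_smul' c φ := ext (congrFun (derivFun_smul c φ.2.1))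

end BUC

/-! ### The operators `A` and `L` on `X = ℂⁿ × BUC_η` -/

/-- The space `X = ℂⁿ × BUC_η`. The product norm is Mathlib's maximum norm, equivalent to the sum
`‖α‖ + ‖φ‖_η` and equal to it on `{0} × BUC_η`. -/
abbrev State (η : ℝ) (n : ℕ) : Type := Cn n × BUC η n

section Operators

variable {η : ℝ} {n : ℕ}

/-- The projection `(0, φ) ↦ φ` from `{0} × BUC¹_η` onto `BUC¹_η`. -/
def toC1 (η : ℝ) (n : ℕ) :
    (Submodule.prod ⊥ (BUC.C1 η n) : Submodule ℂ (State η n)) →ₗ[ℂ] BUC.C1 η n :=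
  LinearMap.codRestrict _ (LinearMap.snd ℂ (Cn n) (BUC η n) ∘ₗ Submodule.subtype _)
    fun x => x.2.2

/-- `A (0, φ) = (-φ'(0), φ')` with domain `D(A) = {0} × BUC¹_η`. -/
def opA (η : ℝ) (n : ℕ) : State η n →ₗ.[ℂ] State η n where
  domain := Submodule.prod ⊥ (BUC.C1 η n)
  toFun := LinearMap.prod (-(BUC.at0 ∘ₗ BUC.deriv)) BUC.deriv ∘ₗ toC1 η n

/-- `L (0, φ) = (L̂ φ, 0)` with domain `{0} × BUC_η`, the closure of `D(A)`. -/
def opL (Lhat : BUC η n →L[ℂ] Cn n) : State η n →ₗ.[ℂ] State η n where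
  domain := Submodule.prod ⊥ ⊤
  toFun := (LinearMap.inl ℂ (Cn n) (BUC η n) ∘ₗ (Lhat : BUC η n →ₗ[ℂ] Cn n) ∘ₗ
    LinearMap.snd ℂ (Cn n) (BUC η n)) ∘ₗ Submodule.subtype _

/-- `θ ↦ e^{zθ} c`, an element of `BUC_η` when `Re z > -η`. -/
def expBUC (η : ℝ) {n : ℕ} (z : ℂ) (c : Cn n) : BUC η n :=
  BUC.mk fun θ => Complex.exp (z * (θ : ℝ)) • c

/-- `θ ↦ ∫_θ^0 (θ - s)ⁱ e^{z(θ - s)} φ(s) ds`, an element of `BUC_η` when `Re z > -η`. -/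
def expIntegral (i : ℕ) (z : ℂ) (φ : BUC η n) : BUC η n :=
  BUC.mk fun θ => ∫ s in (θ : ℝ)..0,
    ((((θ : ℝ) - s : ℝ) : ℂ) ^ i * Complex.exp (z * ((θ : ℝ) - s : ℝ))) • φ.onReal s

/-- The extension of `θ ↦ e^{ηθ} φ(θ)` to `ℝ` by a constant is uniformly continuous. -/
theorem BUC.uniformContinuous_weighted (φ : BUC η n) :
    UniformContinuous (IicExtend fun θ : Iic (0 : ℝ) => Real.exp (η * θ) • φ θ) := by
  refine φ.mem.1.comp ?_
  refine Metric.uniformContinuous_iff.2 fun ε hε => ⟨ε, hε, fun {a b} hab => ?_⟩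
  refine lt_of_le_of_lt ?_ hab
  simp only [Subtype.dist_eq, Real.dist_eq, coe_projIic]
  simpa [Real.dist_eq] using abs_min_sub_min_le_max 0 a 0 b

/-- The function `θ ↦ e^{zθ} c` belongs to `BUC_η` when `Re z > -η`. -/
theorem exp_mem {z : ℂ} (hz : -η < z.re) (c : Cn n) :
    (fun θ : Iic (0 : ℝ) => Complex.exp (z * (θ : ℝ)) • c) ∈ bucSubmodule η n := by
  have hw : ∀ θ : ℝ, Real.exp (η * θ) • (Complex.exp (z * θ) • c) =
      Complex.exp ((z + η) * θ) • c := by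
    intro θ
    rw [← Complex.coe_smul, smul_smul, Complex.ofReal_exp, ← Complex.exp_add]
    push_cast
    ring_nf
  have hn : ∀ θ : ℝ, θ ≤ 0 → ‖Complex.exp ((z + η) * θ)‖ ≤ 1 := by
    intro θ hθ
    rw [Complex.norm_exp]
    simp only [Complex.mul_re, Complex.add_re, Complex.ofReal_re, Complex.add_im,
      Complex.ofReal_im, mul_zero, sub_zero]
    exact Real.exp_le_one_iff.2 (mul_nonpos_of_nonneg_of_nonpos (by linarith) hθ)
  refine ⟨?_, ‖c‖, fun θ => ?_⟩
  · have h1 : LipschitzOnWith (‖z + η‖₊ * ‖c‖₊)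
        (fun θ : ℝ => Complex.exp ((z + η) * θ) • c) (Iic 0) := by
      refine (convex_Iic (0 : ℝ)).lipschitzOnWith_of_nnnorm_hasDerivWithin_le
        (f' := fun θ : ℝ => (Complex.exp ((z + η) * θ) * (z + η)) • c) ?_ ?_
      · intro θ _
        have h2 : HasDerivAt (fun θ : ℝ => (z + η) * (θ : ℂ)) (z + η) θ := by
          simpa using (Complex.ofRealCLM.hasDerivAt (x := θ)).const_mul (z + η)
        exact (h2.cexp.smul_const c).hasDerivWithinAt
      · intro θ hθ
        rw [nnnorm_smul, nnnorm_mul]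
        have h3 : ‖Complex.exp ((z + η) * θ)‖₊ ≤ 1 := hn θ hθ
        gcongr
        calc _ ≤ 1 * ‖z + η‖₊ := by gcongr
          _ = _ := one_mul _
    have h4 := uniformContinuousOn_iff_restrict.1 h1.uniformContinuousOn
    have h5 : (fun θ : Iic (0 : ℝ) => Real.exp (η * θ) • (Complex.exp (z * (θ : ℝ)) • c)) =
        (Iic 0).domRestrict (fun θ : ℝ => Complex.exp ((z + η) * θ) • c) := funext fun θ => hw θ
    rw [h5]
    exact h4
  · have h5 := congrArg norm (hw θ)
    rw [norm_smul, Real.norm_eq_abs, abs_of_pos (Real.exp_pos _)] at h5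
    rw [h5, norm_smul]
    exact mul_le_of_le_one_left (norm_nonneg c) (hn θ θ.2)

/-- Convolution of a bounded uniformly continuous function with an exponentially decaying kernel. -/
theorem convolution_aux {u : ℝ → Cn n} {k : ℝ → ℂ} {M C b : ℝ} (hb : 0 < b)
    (hu : UniformContinuous u) (hM : ∀ s ≤ 0, ‖u s‖ ≤ M) (hk : Continuous k)
    (hC : ∀ r ≤ 0, ‖k r‖ ≤ C * Real.exp (b * r)) :
    UniformContinuous (fun θ : Iic (0 : ℝ) => ∫ r in (θ : ℝ)..0, k r • u (θ - r)) ∧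
    ∃ K, ∀ θ : Iic (0 : ℝ), ‖∫ r in (θ : ℝ)..0, k r • u (θ - r)‖ ≤ K := by
  have hC0 : 0 ≤ C := by simpa using (norm_nonneg _).trans (hC 0 le_rfl)
  have hM0 : 0 ≤ M := (norm_nonneg _).trans (hM 0 le_rfl)
  have hint : ∀ (e θ : ℝ), 0 ≤ e → θ ≤ 0 →
      ∀ f : ℝ → Cn n, (∀ r ∈ Ioc θ 0, ‖f r‖ ≤ e) →
      ‖∫ r in θ..0, k r • f r‖ ≤ e * (C / b) := by
    intro e θ he hθ f hf
    have h1 : ∫ r in θ..0, e * (C * Real.exp (b * r)) ≤ e * (C / b) := by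
      rw [intervalIntegral.integral_const_mul, intervalIntegral.integral_const_mul,
        intervalIntegral.integral_comp_mul_left _ hb.ne', integral_exp]
      refine mul_le_mul_of_nonneg_left ?_ he
      rw [div_eq_mul_inv]
      refine mul_le_mul_of_nonneg_left ?_ hC0
      have := Real.exp_pos (b * θ)
      have h3 : 0 ≤ b⁻¹ := by positivity
      simp only [mul_zero, Real.exp_zero, smul_eq_mul]
      nlinarith
    refine (intervalIntegral.norm_integral_le_of_norm_le hθ ?_ ?_).trans h1
    · refine Eventually.of_forall fun r hr => ?_
      rw [norm_smul, mul_comm]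
      exact mul_le_mul (hf r hr) (hC r hr.2) (norm_nonneg _) he
    · exact Continuous.intervalIntegrable (by fun_prop) _ _
  have hII : ∀ (θ a c : ℝ), IntervalIntegrable (fun r => k r • u (θ - r)) MeasureTheory.volume a c :=
    fun θ a c => (hk.smul (hu.continuous.comp (by fun_prop))).intervalIntegrable _ _
  have key : ∀ ε > 0, ∃ δ > 0, ∀ θ θ' : ℝ, θ' ≤ θ → θ ≤ 0 → θ - θ' < δ →
      ‖(∫ r in θ..0, k r • u (θ - r)) - ∫ r in θ'..0, k r • u (θ' - r)‖ < ε := by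
    intro ε hε
    have hCb : 0 ≤ C / b := by positivity
    obtain ⟨δ, hδ, h⟩ := Metric.uniformContinuous_iff.1 hu (ε / 2 / (C / b + 1)) (by positivity)
    refine ⟨min δ (ε / 2 / (C * M + 1)), lt_min hδ (by positivity), fun θ θ' hle hθ hd => ?_⟩
    have e1 : (∫ r in θ..0, k r • u (θ - r)) - ∫ r in θ'..0, k r • u (θ' - r) =
        (∫ r in θ..0, k r • (u (θ - r) - u (θ' - r))) - ∫ r in θ'..θ, k r • u (θ' - r) := by
      rw [← intervalIntegral.integral_add_adjacent_intervals (hII θ' θ' θ) (hII θ' θ 0)]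
      simp only [smul_sub]
      rw [intervalIntegral.integral_sub (hII θ θ 0) (hII θ' θ 0)]
      abel
    have e2 : ‖∫ r in θ..0, k r • (u (θ - r) - u (θ' - r))‖ ≤
        ε / 2 / (C / b + 1) * (C / b) := by
      refine hint _ θ (by positivity) hθ _ fun r _ => ?_
      rw [← dist_eq_norm]
      refine (h ?_).le
      rw [Real.dist_eq, sub_sub_sub_cancel_right, abs_of_nonneg (by linarith)]
      exact hd.trans_le (min_le_left _ _)
    have e3 : ‖∫ r in θ'..θ, k r • u (θ' - r)‖ ≤ C * M * |θ - θ'| := by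
      refine intervalIntegral.norm_integral_le_of_norm_le_const fun r hr => ?_
      rw [uIoc_of_le hle] at hr
      rw [norm_smul]
      have hr0 : r ≤ 0 := hr.2.trans hθ
      have h1 : ‖k r‖ ≤ C := (hC r hr0).trans (mul_le_of_le_one_right hC0
        (Real.exp_le_one_iff.2 (mul_nonpos_of_nonneg_of_nonpos hb.le hr0)))
      exact mul_le_mul h1 (hM _ (by linarith [hr.1])) (norm_nonneg _) hC0
    rw [abs_of_nonneg (by linarith)] at e3
    have e4 : ε / 2 / (C / b + 1) * (C / b) ≤ ε / 2 := by
      rw [div_mul_eq_mul_div, div_le_iff₀ (by positivity)]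
      nlinarith
    have e5 : C * M * (θ - θ') < ε / 2 := by
      have h1 := hd.trans_le (min_le_right _ _)
      have h2 : 0 ≤ C * M := by positivity
      rw [lt_div_iff₀ (by positivity)] at h1
      nlinarith
    rw [e1]
    exact (norm_sub_le _ _).trans_lt (by linarith)
  constructor
  · refine Metric.uniformContinuous_iff.2 fun ε hε => ?_
    obtain ⟨δ, hδ, h⟩ := key ε hε
    refine ⟨δ, hδ, fun {a c} hac => ?_⟩
    rw [Subtype.dist_eq, Real.dist_eq] at hac
    rw [dist_eq_norm]
    rcases le_total (c : ℝ) a with hle | hle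
    · exact h a c hle a.2 ((le_abs_self _).trans_lt hac)
    · rw [norm_sub_rev]
      exact h c a hle c.2 ((le_abs_self _).trans_lt (by rwa [abs_sub_comm]))
  · exact ⟨M * (C / b), fun θ => hint M θ hM0 θ.2 _ fun r hr => hM _ (by linarith [hr.1])⟩

/-- The function `θ ↦ ∫_θ^0 (θ - s)ⁱ e^{z(θ - s)} φ(s) ds` belongs to `BUC_η` when `Re z > -η`. -/
theorem expIntegral_mem (i : ℕ) {z : ℂ} (hz : -η < z.re) (φ : BUC η n) :
    (fun θ : Iic (0 : ℝ) => ∫ s in (θ : ℝ)..0,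
      ((((θ : ℝ) - s : ℝ) : ℂ) ^ i * Complex.exp (z * ((θ : ℝ) - s : ℝ))) • φ.onReal s) ∈
      bucSubmodule η n := by
  set u : ℝ → Cn n := IicExtend fun θ : Iic (0 : ℝ) => Real.exp (η * θ) • φ θ with hu
  set k : ℝ → ℂ := fun r => (r : ℂ) ^ i * Complex.exp ((z + η) * r) with hk
  have hus : ∀ s ≤ 0, u s = Real.exp (η * s) • φ.onReal s := by
    intro s hs
    rw [hu, BUC.onReal, IicExtend_of_mem _ hs, IicExtend_of_mem _ hs]
  obtain ⟨M, hM⟩ := φ.mem.2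
  set a : ℝ := z.re + η with ha
  have ha0 : 0 < a := by linarith
  have hC : ∀ r ≤ 0, ‖k r‖ ≤ (i.factorial * (2 / a) ^ i) * Real.exp (a / 2 * r) := by
    intro r hr
    have h1 := Real.pow_div_factorial_le_exp (a / 2 * (-r)) (by nlinarith) i
    rw [div_le_iff₀ (by positivity), mul_pow] at h1
    have h2 : ‖k r‖ = (-r) ^ i * Real.exp (a * r) := by
      rw [hk]
      simp only [norm_mul, norm_pow, Complex.norm_real, Real.norm_eq_abs, abs_of_nonpos hr,
        Complex.norm_exp]
      simp [ha]
    have h3 : Real.exp (a * r) = Real.exp (a / 2 * r) * Real.exp (a / 2 * r) := by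
      rw [← Real.exp_add]
      ring_nf
    have h4 : Real.exp (a / 2 * -r) * Real.exp (a / 2 * r) = 1 := by
      rw [← Real.exp_add]
      simp
    have h5 : (-r) ^ i ≤ (2 / a) ^ i * (Real.exp (a / 2 * -r) * i.factorial) := by
      have h6 : (-r) ^ i = (2 / a) ^ i * ((a / 2) ^ i * (-r) ^ i) := by
        rw [← mul_assoc, ← mul_pow]
        field_simp
        simp
      rw [h6]
      gcongr
    rw [h2, h3]
    calc _ ≤ (2 / a) ^ i * (Real.exp (a / 2 * -r) * i.factorial) *
          (Real.exp (a / 2 * r) * Real.exp (a / 2 * r)) := by gcongr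
      _ = (i.factorial * (2 / a) ^ i) * Real.exp (a / 2 * r) *
          (Real.exp (a / 2 * -r) * Real.exp (a / 2 * r)) := by ring
      _ = _ := by rw [h4, mul_one]
  have hconv := convolution_aux (u := u) (k := k) (M := M) (half_pos ha0)
    φ.uniformContinuous_weighted
    (fun s hs => by
      rw [hu, IicExtend_of_mem _ hs, norm_smul, Real.norm_eq_abs, abs_of_pos (Real.exp_pos _)]
      exact hM ⟨s, hs⟩) (by fun_prop) hC
  have heq : ∀ θ : Iic (0 : ℝ), Real.exp (η * θ) • (∫ s in (θ : ℝ)..0,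
      ((((θ : ℝ) - s : ℝ) : ℂ) ^ i * Complex.exp (z * ((θ : ℝ) - s : ℝ))) • φ.onReal s) =
      ∫ r in (θ : ℝ)..0, k r • u (θ - r) := by
    intro θ
    have h1 := intervalIntegral.integral_comp_sub_left (a := (θ : ℝ)) (b := 0)
      (fun r => k r • u (θ - r)) (θ : ℝ)
    simp only [sub_zero, sub_self, sub_sub_cancel] at h1
    rw [← h1, ← intervalIntegral.integral_smul]
    refine intervalIntegral.integral_congr fun s hs => ?_
    have hθ : (θ : ℝ) ≤ 0 := θ.2
    rw [uIcc_of_le hθ] at hs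
    simp only [hk]
    rw [hus s hs.2, ← Complex.coe_smul, ← Complex.coe_smul, smul_smul, smul_smul]
    congr 1
    rw [mul_left_comm, mul_assoc, Complex.ofReal_exp, Complex.ofReal_exp, ← Complex.exp_add,
      ← Complex.exp_add]
    push_cast
    ring_nf
  obtain ⟨K, hK⟩ := hconv.2
  refine ⟨?_, K, fun θ => ?_⟩
  · simp only [heq]
    exact hconv.1
  · have := hK θ
    rw [← heq, norm_smul, Real.norm_eq_abs, abs_of_pos (Real.exp_pos _)] at this
    exact this

/-- The characteristic matrix `Δ(z) = z I - L̂(e^{z·} I)`, whose `j`-th column is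
`z eⱼ - L̂(e^{z·} eⱼ)`. -/
def Delta (Lhat : BUC η n →L[ℂ] Cn n) (z : ℂ) : Matrix (Fin n) (Fin n) ℂ :=
  z • (1 : Matrix (Fin n) (Fin n) ℂ) -
    Matrix.of fun i j => Lhat (expBUC η z (EuclideanSpace.single j 1)) i

/-- `Δ(z)⁻¹` as an operator on `ℂⁿ` (`0` where `det Δ(z) = 0`). -/
def DeltaInv (Lhat : BUC η n →L[ℂ] Cn n) (z : ℂ) : Cn n →L[ℂ] Cn n :=
  Matrix.toEuclideanCLM (𝕜 := ℂ) (Delta Lhat z)⁻¹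

/-- `α + φ(0) + L̂(∫_·^0 e^{z(· - s)} φ(s) ds)` for `x = (α, φ)`. -/
def bracket (Lhat : BUC η n →L[ℂ] Cn n) (x : State η n) (z : ℂ) : Cn n :=
  x.1 + BUC.at0 x.2 + Lhat (expIntegral 0 z x.2)

/-- `L₀²(z)(α, φ) = e^{z·} [α + φ(0) + L̂(∫_·^0 e^{z(· - s)} φ(s) ds)] ∈ BUC_η`. -/
def Ltwo (Lhat : BUC η n →L[ℂ] Cn n) (x : State η n) (z : ℂ) : BUC η n :=
  expBUC η z (bracket Lhat x z)

end Operators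

end DelayEq
end

/-! In the half-plane `Re z > -η` the equation `(z - (A + L))(0, φ) = (α, ψ)` is an ordinary
differential equation with a boundary condition. Its second component says `φ' = zφ - ψ`, hence `φ =
e^{z·} c + ∫_·^0 e^{z(· - s)} ψ(s) ds` with `c = φ(0)` (`eq_of_isDeriv`). Its first component then
becomes `Δ(z) c = b(z)`, where `b` is the bracket of `(α, ψ)`. So wherever `det Δ(z) ≠ 0` the
resolvent is `e^{z·} Δ(z)⁻¹ b(z)` plus the integral term (`isResolventAt_resolventFormula`).

Apart from `Δ⁻¹`, every factor in this formula is holomorphic in operator norm, because the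
exponential and integral operators satisfy resolvent-type identities (`integralCLM_sub`,
`expCLM_sub`). By Cramer's rule `Δ⁻¹` is meromorphic, since `det Δ` is holomorphic and nonzero at
large real `z`. A spectral point is a zero of `det Δ`, hence a pole of `Δ⁻¹`
(`exists_pole_DeltaInv`). Writing `Δ⁻¹ = (z - lam₀)^{-k} g` makes the resolvent `(z - lam₀)^{-k} G`
with `G` analytic and `G(lam₀) ≠ 0`, so the orders agree. The integral term has no singular part,
and the Cauchy product of `g` with `L₀²` gives the formula for `B₋₁`.

That `B₋₁` projects onto the generalized eigenspace holds for any pole of a resolvent: comparing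
Taylor coefficients in the two resolvent identities gives recurrences showing that `B₋₁` maps into
the generalized eigenspace and is the identity there.

If only `Re lam₀ > ω_{0,ess}` is given, it remains to see that `-η ≤ ω_{0,ess}` when `n > 0`. The
semigroup moves the history `φ` to the left, so `‖T(t)x‖ ≥ e^{-ηt}‖x‖` on the domain of its
generator (`exp_mul_norm_le_norm_semigroup`). That domain is infinite-dimensional, and Riesz's lemma
turns the estimate into a lower bound for the essential norm (`exists_mul_le_essNorm`). -/

noncomputable section
namespace DelayEq

/-! ### Completeness of `BUC_η` and derivatives inside it -/

namespace BUC

variable {η : ℝ} {n : ℕ}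

theorem continuous_coe (φ : BUC η n) : Continuous (φ : Iic (0 : ℝ) → Cn n) := by
  have h : (φ : Iic (0 : ℝ) → Cn n) = fun θ : Iic (0 : ℝ) =>
      Real.exp (-(η * θ)) • (Real.exp (η * θ) • φ θ) := by
    funext θ
    rw [smul_smul, ← Real.exp_add, neg_add_cancel, Real.exp_zero, one_smul]
  rw [h]
  have h' : Continuous fun θ : Iic (0 : ℝ) => Real.exp (-(η * θ)) := by fun_prop
  exact h'.smul φ.mem.1.continuous

theorem continuous_onReal (φ : BUC η n) : Continuous φ.onReal :=
  φ.continuous_coe.comp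
    (Continuous.subtype_mk (by fun_prop : Continuous fun x : ℝ => min 0 x) fun _ =>
      mem_Iic.2 (min_le_left _ _))

theorem onReal_of_le (φ : BUC η n) {θ : ℝ} (h : θ ≤ 0) : φ.onReal θ = φ ⟨θ, h⟩ :=
  IicExtend_of_mem _ h

@[simp] theorem onReal_coe (φ : BUC η n) (θ : Iic (0 : ℝ)) : φ.onReal θ = φ θ :=
  φ.onReal_of_le θ.2

theorem ext_onReal {φ ψ : BUC η n} (h : ∀ θ ≤ 0, φ.onReal θ = ψ.onReal θ) : φ = ψ :=
  ext fun θ => by rw [← onReal_coe, ← onReal_coe, h θ θ.2]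

@[simp] theorem sub_apply (φ ψ : BUC η n) (θ : Iic (0 : ℝ)) : (φ - ψ) θ = φ θ - ψ θ := rfl

theorem norm_apply_le (φ : BUC η n) (θ : Iic (0 : ℝ)) :
    ‖φ θ‖ ≤ Real.exp (-(η * θ)) * ‖φ‖ := by
  have h := mul_le_mul_of_nonneg_left (φ.le_norm θ) (Real.exp_pos (-(η * θ))).le
  rwa [← mul_assoc, ← Real.exp_add, neg_add_cancel, Real.exp_zero, one_mul] at h

/-- Evaluation at a point of `(-∞, 0]`. -/
def evalCLM (η : ℝ) (n : ℕ) (θ : Iic (0 : ℝ)) : BUC η n →L[ℂ] Cn n :=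
  LinearMap.mkContinuous ⟨⟨fun φ => φ θ, fun _ _ => rfl⟩, fun _ _ => rfl⟩ (Real.exp (-(η * θ)))
    fun φ => φ.norm_apply_le θ

@[simp] theorem evalCLM_apply (θ : Iic (0 : ℝ)) (φ : BUC η n) : evalCLM η n θ φ = φ θ := rfl

theorem at0_eq (φ : BUC η n) : at0 φ = evalCLM η n ⟨0, self_mem_Iic⟩ φ := rfl

theorem at0_eq_onReal (φ : BUC η n) : at0 φ = φ.onReal 0 := (φ.onReal_of_le le_rfl).symm

/-- The weighted Cauchy estimate is uniform in `θ`, so it survives the pointwise limit, which is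
then a uniform limit of the weighted functions and inherits their uniform continuity. Completeness
is what makes complex differentiable functions with values in operators on `BUC_η` analytic. -/
theorem exists_tendsto {u : ℕ → BUC η n} (hu : CauchySeq u) :
    ∃ φ, Tendsto u atTop (𝓝 φ) := by
  have hw : ∀ (φ : BUC η n) (θ : Iic (0 : ℝ)),
      ‖Real.exp (η * θ) • φ θ‖ = Real.exp (η * θ) * ‖φ θ‖ := fun φ θ => by
    rw [norm_smul, Real.norm_eq_abs, abs_of_pos (Real.exp_pos _)]
  have hpt : ∀ θ, ∃ c, Tendsto (fun k => u k θ) atTop (𝓝 c) := fun θ =>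
    cauchySeq_tendsto_of_complete (u := fun k => u k θ)
      (hu.map (evalCLM η n θ).uniformContinuous)
  choose f hf using hpt
  have hclose : ∀ ε > 0, ∃ N, ∀ k ≥ N, ∀ θ : Iic (0 : ℝ),
      Real.exp (η * θ) * ‖u k θ - f θ‖ ≤ ε := by
    intro ε hε
    obtain ⟨N, hN⟩ := Metric.cauchySeq_iff.1 hu ε hε
    refine ⟨N, fun k hk θ => ?_⟩
    have hlim : Tendsto (fun m => Real.exp (η * θ) * ‖u k θ - u m θ‖) atTop
        (𝓝 (Real.exp (η * θ) * ‖u k θ - f θ‖)) :=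
      ((tendsto_const_nhds.sub (hf θ)).norm).const_mul _
    refine le_of_tendsto hlim ?_
    filter_upwards [eventually_ge_atTop N] with m hm
    have := hN k hk m hm
    rw [dist_eq_norm] at this
    exact ((u k - u m).le_norm θ).trans this.le
  have hmem : f ∈ bucSubmodule η n := by
    constructor
    · have ht : TendstoUniformly (fun k (θ : Iic (0 : ℝ)) => Real.exp (η * θ) • u k θ)
          (fun θ => Real.exp (η * θ) • f θ) atTop := by
        refine Metric.tendstoUniformly_iff.2 fun ε hε => ?_
        obtain ⟨N, hN⟩ := hclose (ε / 2) (half_pos hε)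
        filter_upwards [eventually_ge_atTop N] with k hk θ
        rw [dist_comm, dist_eq_norm, ← smul_sub, norm_smul, Real.norm_eq_abs,
          abs_of_pos (Real.exp_pos _)]
        linarith [hN k hk θ]
      exact ht.uniformContinuous (Frequently.of_forall fun k => (u k).mem.1)
    · obtain ⟨N, hN⟩ := hclose 1 one_pos
      refine ⟨‖u N‖ + 1, fun θ => ?_⟩
      have h1 := hN N le_rfl θ
      have h2 := (u N).le_norm θ
      have h3 : ‖f θ‖ ≤ ‖u N θ‖ + ‖u N θ - f θ‖ := by
        simpa using norm_sub_le (u N θ) (u N θ - f θ)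
      have h4 := mul_le_mul_of_nonneg_left h3 (Real.exp_pos (η * θ)).le
      linarith
  refine ⟨ofMem f hmem, Metric.tendsto_atTop.2 fun ε hε => ?_⟩
  obtain ⟨N, hN⟩ := hclose (ε / 2) (half_pos hε)
  refine ⟨N, fun k hk => ?_⟩
  rw [dist_eq_norm]
  refine lt_of_le_of_lt (norm_le _ fun θ => ?_) (half_lt_self hε)
  rw [sub_apply, ofMem_apply]
  exact hN k hk θ

instance : CompleteSpace (BUC η n) :=
  Metric.complete_of_cauchySeq_tendsto fun _ hu => exists_tendsto hu

/-- `χ` is the derivative of `φ`, one-sided at `0`. -/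
def IsDeriv (φ χ : BUC η n) : Prop :=
  ∀ θ ≤ 0, HasDerivWithinAt φ.onReal (χ.onReal θ) (Iic 0) θ

theorem IsDeriv.add {φ χ φ' χ' : BUC η n} (h : IsDeriv φ χ) (h' : IsDeriv φ' χ') :
    IsDeriv (φ + φ') (χ + χ') := fun θ hθ => (h θ hθ).add (h' θ hθ)

theorem IsDeriv.smul {φ χ : BUC η n} (c : ℂ) (h : IsDeriv φ χ) :
    IsDeriv (c • φ) (c • χ) := fun θ hθ => (h θ hθ).const_smul c

theorem IsDeriv.derivFun_eq {φ χ : BUC η n} (h : IsDeriv φ χ) : φ.derivFun = χ := by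
  funext θ
  rw [derivFun, (h θ θ.2).derivWithin (uniqueDiffOn_Iic 0 _ θ.2), onReal_coe]

theorem IsDeriv.mem {φ χ : BUC η n} (h : IsDeriv φ χ) : φ ∈ C1 η n :=
  ⟨fun θ hθ => (h θ hθ).differentiableWithinAt, by rw [h.derivFun_eq]; exact χ.mem⟩

theorem IsDeriv.deriv_eq {φ χ : BUC η n} (h : IsDeriv φ χ) : deriv ⟨φ, h.mem⟩ = χ :=
  ext fun θ => congrFun h.derivFun_eq θ

theorem isDeriv_deriv (φ : C1 η n) : IsDeriv (φ : BUC η n) (deriv φ) := by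
  intro θ hθ
  rw [onReal_of_le _ hθ]
  exact (φ.2.1 θ hθ).hasDerivWithinAt

end BUC

open BUC

variable {η : ℝ} {n : ℕ}

/-! ### Variation of constants for `φ' = zφ - ψ` -/

theorem expBUC_apply {z : ℂ} (hz : -η < z.re) (c : Cn n) (θ : Iic (0 : ℝ)) :
    expBUC η z c θ = Complex.exp (z * (θ : ℝ)) • c := mk_apply (exp_mem hz c) θ

theorem expIntegral_apply (i : ℕ) {z : ℂ} (hz : -η < z.re) (φ : BUC η n) (θ : Iic (0 : ℝ)) :
    expIntegral i z φ θ = ∫ s in (θ : ℝ)..0,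
      ((((θ : ℝ) - s : ℝ) : ℂ) ^ i * Complex.exp (z * ((θ : ℝ) - s : ℝ))) • φ.onReal s :=
  mk_apply (expIntegral_mem i hz φ) θ

theorem expBUC_onReal {z : ℂ} (hz : -η < z.re) (c : Cn n) {θ : ℝ} (hθ : θ ≤ 0) :
    (expBUC η z c).onReal θ = Complex.exp (z * θ) • c := by
  rw [onReal_of_le _ hθ, expBUC_apply hz]

/-- Factoring out `e^{zθ}` leaves an integrand independent of `θ`, so the fundamental theorem of
calculus applies to the lower limit. -/
theorem expIntegral_onReal {z : ℂ} (hz : -η < z.re) (φ : BUC η n) {θ : ℝ} (hθ : θ ≤ 0) :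
    (expIntegral 0 z φ).onReal θ =
      Complex.exp (z * θ) • ∫ s in θ..0, Complex.exp (-(z * s)) • φ.onReal s := by
  rw [onReal_of_le _ hθ, expIntegral_apply 0 hz, ← intervalIntegral.integral_smul]
  refine intervalIntegral.integral_congr fun s _ => ?_
  simp only [pow_zero, one_mul, smul_smul, ← Complex.exp_add]
  push_cast
  ring_nf

theorem expBUC_at0 {z : ℂ} (hz : -η < z.re) (c : Cn n) : at0 (expBUC η z c) = c := by
  rw [at0_eq_onReal, expBUC_onReal hz c le_rfl]
  simp

theorem expIntegral_at0 {z : ℂ} (hz : -η < z.re) (φ : BUC η n) :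
    at0 (expIntegral 0 z φ) = 0 := by
  rw [at0_eq_onReal, expIntegral_onReal hz φ le_rfl]
  simp

theorem hasDerivAt_cexp_mul_ofReal (z : ℂ) (θ : ℝ) :
    HasDerivAt (fun θ : ℝ => Complex.exp (z * θ)) (z * Complex.exp (z * θ)) θ := by
  have h2 : HasDerivAt (fun θ : ℝ => z * (θ : ℂ)) z θ := by
    simpa using (Complex.ofRealCLM.hasDerivAt (x := θ)).const_mul z
  simpa [mul_comm] using h2.cexp

theorem isDeriv_expBUC {z : ℂ} (hz : -η < z.re) (c : Cn n) :
    IsDeriv (expBUC η z c) (z • expBUC η z c) := by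
  intro θ hθ
  have h := ((hasDerivAt_cexp_mul_ofReal z θ).smul_const c).hasDerivWithinAt (s := Iic 0)
  rw [onReal_smul, Pi.smul_apply, expBUC_onReal hz c hθ, smul_smul]
  exact h.congr (fun s hs => expBUC_onReal hz c hs) (expBUC_onReal hz c hθ)

theorem isDeriv_expIntegral {z : ℂ} (hz : -η < z.re) (φ : BUC η n) :
    IsDeriv (expIntegral 0 z φ) (z • expIntegral 0 z φ - φ) := by
  intro θ hθ
  have hc : Continuous fun s : ℝ => Complex.exp (-(z * s)) • φ.onReal s :=
    (by fun_prop : Continuous fun s : ℝ => Complex.exp (-(z * s))).smul φ.continuous_onReal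
  have h1 := intervalIntegral.integral_hasDerivAt_left (hc.intervalIntegrable θ 0)
    (hc.stronglyMeasurableAtFilter _ _) hc.continuousAt
  have h := ((hasDerivAt_cexp_mul_ofReal z θ).smul h1).hasDerivWithinAt (s := Iic 0)
  have e : (z • expIntegral 0 z φ - φ).onReal θ =
      z • (expIntegral 0 z φ).onReal θ - φ.onReal θ := rfl
  rw [e, expIntegral_onReal hz φ hθ]
  refine (h.congr (fun s hs => expIntegral_onReal hz φ hs)
    (expIntegral_onReal hz φ hθ)).congr_deriv ?_
  rw [smul_neg, smul_smul, smul_smul, ← Complex.exp_add, add_neg_cancel, Complex.exp_zero,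
    one_smul]
  abel

/-- Variation of constants. -/
theorem eq_of_isDeriv {z : ℂ} (hz : -η < z.re) {φ ψ : BUC η n} (h : IsDeriv φ (z • φ - ψ)) :
    φ = expBUC η z (at0 φ) + expIntegral 0 z ψ := by
  refine ext_onReal fun θ hθ => ?_
  have e : (expBUC η z (at0 φ) + expIntegral 0 z ψ).onReal θ =
    (expBUC η z (at0 φ)).onReal θ + (expIntegral 0 z ψ).onReal θ := rfl
  rw [e, expBUC_onReal hz _ hθ, expIntegral_onReal hz _ hθ]
  have hc : Continuous fun s : ℝ => Complex.exp (-(z * s)) • ψ.onReal s :=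
    (by fun_prop : Continuous fun s : ℝ => Complex.exp (-(z * s))).smul ψ.continuous_onReal
  -- By the equation, `-e^{-zs} φ(s)` is a primitive of `e^{-zs} ψ(s)` on the interior of `[θ, 0]`,
  -- where the derivative of `φ` is two-sided.
  have h1 := intervalIntegral.integral_eq_sub_of_hasDerivAt_of_le hθ
    (f := fun s : ℝ => -(Complex.exp (-z * s) • φ.onReal s))
    (f' := fun s : ℝ => Complex.exp (-(z * s)) • ψ.onReal s)
    (by have := φ.continuous_onReal; fun_prop)
    (fun s hs => by
      have h2 := (h s hs.2.le).hasDerivAt (Iic_mem_nhds hs.2)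
      have h3 := ((hasDerivAt_cexp_mul_ofReal (-z) s).smul h2).neg
      refine h3.congr_deriv ?_
      have e : (z • φ - ψ).onReal s = z • φ.onReal s - ψ.onReal s := rfl
      rw [e, smul_sub, smul_smul, neg_mul, neg_mul, mul_comm z (Complex.exp _), neg_smul]
      abel) (hc.intervalIntegrable _ _)
  rw [h1, at0_eq_onReal, smul_sub, smul_neg, smul_neg, smul_smul, ← Complex.exp_add]
  simp [smul_smul, ← Complex.exp_add]

theorem expBUC_add {z : ℂ} (hz : -η < z.re) (c d : Cn n) :
    expBUC η z (c + d) = expBUC η z c + expBUC η z d :=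
  ext fun θ => by simp [expBUC_apply hz]

theorem expBUC_smul {z : ℂ} (hz : -η < z.re) (a : ℂ) (c : Cn n) :
    expBUC η z (a • c) = a • expBUC η z c :=
  ext fun θ => by simp only [expBUC_apply hz, smul_apply]; rw [smul_comm]

theorem expBUC_zero {z : ℂ} (hz : -η < z.re) : expBUC η z (0 : Cn n) = 0 :=
  ext fun θ => by simp [expBUC_apply hz]

/-- Additivity comes from uniqueness: the right-hand side solves `χ' = zχ - (φ + ψ)` with `χ(0) =
0`. -/
theorem expIntegral_add {z : ℂ} (hz : -η < z.re) (φ ψ : BUC η n) :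
    expIntegral 0 z (φ + ψ) = expIntegral 0 z φ + expIntegral 0 z ψ := by
  have h := (isDeriv_expIntegral hz φ).add (isDeriv_expIntegral hz ψ)
  have e : z • expIntegral 0 z φ - φ + (z • expIntegral 0 z ψ - ψ) =
      z • (expIntegral 0 z φ + expIntegral 0 z ψ) - (φ + ψ) := by rw [smul_add]; abel
  rw [e] at h
  have := eq_of_isDeriv hz h
  rw [map_add, expIntegral_at0 hz, expIntegral_at0 hz, add_zero, expBUC_zero hz, zero_add] at this
  exact this.symm

theorem expIntegral_smul {z : ℂ} (hz : -η < z.re) (a : ℂ) (φ : BUC η n) :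
    expIntegral 0 z (a • φ) = a • expIntegral 0 z φ := by
  have h := (isDeriv_expIntegral hz φ).smul a
  rw [smul_sub, smul_comm] at h
  have := eq_of_isDeriv hz h
  rw [map_smul, expIntegral_at0 hz, smul_zero, expBUC_zero hz, zero_add] at this
  exact this.symm

theorem norm_expBUC_le {z : ℂ} (hz : -η < z.re) (c : Cn n) : ‖expBUC η z c‖ ≤ ‖c‖ := by
  refine norm_le _ fun θ => ?_
  rw [expBUC_apply hz, norm_smul, Complex.norm_exp, ← mul_assoc, ← Real.exp_add]
  refine mul_le_of_le_one_left (norm_nonneg c) (Real.exp_le_one_iff.2 ?_)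
  have hθ : (θ : ℝ) ≤ 0 := θ.2
  simp only [Complex.mul_re, Complex.ofReal_re, Complex.ofReal_im, mul_zero, sub_zero]
  nlinarith

/-- After weighting, the kernel is `e^{(Re z + η)r}` on `r ≤ 0`, whose integral is `(Re z + η)⁻¹`.
-/
theorem norm_expIntegral_le {z : ℂ} (hz : -η < z.re) (φ : BUC η n) :
    ‖expIntegral 0 z φ‖ ≤ (z.re + η)⁻¹ * ‖φ‖ := by
  refine norm_le _ fun θ => ?_
  have hθ : (θ : ℝ) ≤ 0 := θ.2
  have ha : 0 < z.re + η := by linarith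
  rw [expIntegral_apply 0 hz]
  have h1 : ‖∫ s in (θ : ℝ)..0,
      ((((θ : ℝ) - s : ℝ) : ℂ) ^ 0 * Complex.exp (z * ((θ : ℝ) - s : ℝ))) • φ.onReal s‖ ≤
      ∫ s in (θ : ℝ)..0, Real.exp (-(η * θ)) * ‖φ‖ * Real.exp ((z.re + η) * (θ - s)) := by
    refine intervalIntegral.norm_integral_le_of_norm_le hθ ?_
      (Continuous.intervalIntegrable (by fun_prop) _ _)
    refine Eventually.of_forall fun s hs => ?_
    rw [pow_zero, one_mul, norm_smul, Complex.norm_exp, onReal_of_le _ hs.2]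
    have h2 := φ.norm_apply_le ⟨s, hs.2⟩
    have h3 : (z * ((θ - s : ℝ) : ℂ)).re = z.re * (θ - s) := by simp
    rw [h3]
    calc _ ≤ Real.exp (z.re * (θ - s)) * (Real.exp (-(η * s)) * ‖φ‖) := by gcongr
      _ = (Real.exp (z.re * (θ - s)) * Real.exp (-(η * s))) * ‖φ‖ := by ring
      _ = (Real.exp (-(η * θ)) * Real.exp ((z.re + η) * (θ - s))) * ‖φ‖ := by
        rw [← Real.exp_add, ← Real.exp_add]
        ring_nf
      _ = _ := by ring
  have h4 : ∫ s in (θ : ℝ)..0, Real.exp ((z.re + η) * (θ - s)) ≤ (z.re + η)⁻¹ := by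
    have h5 := intervalIntegral.integral_comp_sub_left (a := (θ : ℝ)) (b := 0)
      (fun r => Real.exp ((z.re + η) * r)) (θ : ℝ)
    simp only [sub_zero, sub_self] at h5
    rw [h5, intervalIntegral.integral_comp_mul_left _ ha.ne', integral_exp]
    have := Real.exp_pos ((z.re + η) * θ)
    simp only [mul_zero, Real.exp_zero, smul_eq_mul]
    have h3 : 0 < (z.re + η)⁻¹ := by positivity
    nlinarith
  rw [intervalIntegral.integral_const_mul] at h1
  calc _ ≤ Real.exp (η * θ) * (Real.exp (-(η * θ)) * ‖φ‖ * (z.re + η)⁻¹) := by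
        gcongr
        exact h1.trans (by gcongr)
    _ = (Real.exp (η * θ) * Real.exp (-(η * θ))) * ((z.re + η)⁻¹ * ‖φ‖) := by ring
    _ = _ := by rw [← Real.exp_add, add_neg_cancel, Real.exp_zero, one_mul]

/-! ### Holomorphic vector-valued functions and Leibniz' rule -/

section Calculus

variable {E F G : Type*} [NormedAddCommGroup E] [NormedSpace ℂ E] [NormedAddCommGroup F]
  [NormedSpace ℂ F] [NormedAddCommGroup G] [NormedSpace ℂ G]

/-- This converts a resolvent-type identity together with mere continuity into complex
differentiability. -/
theorem hasDerivAt_of_sub_eq_smul {f h : ℂ → E} {w : ℂ}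
    (hf : ∀ᶠ z in 𝓝 w, f z - f w = (z - w) • h z) (hh : ContinuousAt h w) :
    HasDerivAt f (h w) w := by
  rw [hasDerivAt_iff_tendsto_slope]
  refine (hh.tendsto.mono_left nhdsWithin_le_nhds).congr' ?_
  filter_upwards [hf.filter_mono nhdsWithin_le_nhds, self_mem_nhdsWithin] with z hz hne
  rw [slope_def_module, hz, smul_smul, inv_mul_cancel₀ (sub_ne_zero.2 hne), one_smul]

theorem analyticAt_bilinear (B : E →L[ℂ] F →L[ℂ] G) {f : ℂ → E} {g : ℂ → F} {z : ℂ}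
    (hf : AnalyticAt ℂ f z) (hg : AnalyticAt ℂ g z) :
    AnalyticAt ℂ (fun w => B (f w) (g w)) z :=
  (B.analyticAt_bilinear (f z, g z)).comp₂ hf hg

theorem analyticAt_clm_apply {f : ℂ → F →L[ℂ] G} {g : ℂ → F} {z : ℂ}
    (hf : AnalyticAt ℂ f z) (hg : AnalyticAt ℂ g z) : AnalyticAt ℂ (fun w => f w (g w)) z :=
  analyticAt_bilinear (ContinuousLinearMap.id ℂ (F →L[ℂ] G)) hf hg

theorem analyticAt_clm_comp {f : ℂ → F →L[ℂ] G} {g : ℂ → E →L[ℂ] F} {z : ℂ}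
    (hf : AnalyticAt ℂ f z) (hg : AnalyticAt ℂ g z) :
    AnalyticAt ℂ (fun w => (f w).comp (g w)) z :=
  analyticAt_bilinear (ContinuousLinearMap.compL ℂ E F G) hf hg

theorem iteratedDeriv_clm_comp [CompleteSpace E] (L : E →L[ℂ] F) {f : ℂ → E} {z : ℂ} (hf : AnalyticAt ℂ f z)
    (m : ℕ) : iteratedDeriv m (fun w => L (f w)) z = L (iteratedDeriv m f z) := by
  rw [iteratedDeriv_eq_iteratedFDeriv, iteratedDeriv_eq_iteratedFDeriv]
  have := L.iteratedFDeriv_comp_left (x := z) (hf.contDiffAt (n := m)) le_rfl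
  exact congrArg (fun T => T fun _ => (1 : ℂ)) this

variable [CompleteSpace E]

theorem iteratedDeriv_add_of_analyticAt {f g : ℂ → E} {z : ℂ} (hf : AnalyticAt ℂ f z)
    (hg : AnalyticAt ℂ g z) (m : ℕ) :
    iteratedDeriv m (fun w => f w + g w) z = iteratedDeriv m f z + iteratedDeriv m g z :=
  iteratedDeriv_fun_add (n := m) hf.contDiffAt hg.contDiffAt

variable [CompleteSpace F] [CompleteSpace G]

/-- Leibniz' rule for a continuous bilinear map. -/
theorem iteratedDeriv_bilinear (B : E →L[ℂ] F →L[ℂ] G) {f : ℂ → E} {g : ℂ → F} {z : ℂ}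
    (hf : AnalyticAt ℂ f z) (hg : AnalyticAt ℂ g z) (m : ℕ) :
    iteratedDeriv m (fun w => B (f w) (g w)) z =
      ∑ ij ∈ Finset.HasAntidiagonal.antidiagonal m,
        m.choose ij.1 • B (iteratedDeriv ij.1 f z) (iteratedDeriv ij.2 g z) := by
  have hBan : ∀ {f : ℂ → E} {g : ℂ → F}, AnalyticAt ℂ f z → AnalyticAt ℂ g z →
      AnalyticAt ℂ (fun w => B (f w) (g w)) z := fun hf hg =>
    analyticAt_bilinear B hf hg
  induction m generalizing f g with
  | zero => simp
  | succ m ih =>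
    rw [Finset.sum_antidiagonal_choose_succ_nsmul
      (fun i j => B (iteratedDeriv i f z) (iteratedDeriv j g z)) m, iteratedDeriv_succ']
    have hd : _root_.deriv (fun w => B (f w) (g w)) =ᶠ[𝓝 z]
        fun w => B (f w) (_root_.deriv g w) + B (_root_.deriv f w) (g w) := by
      filter_upwards [hf.eventually_analyticAt, hg.eventually_analyticAt] with w hfw hgw
      have h1 := (B.hasFDerivAt.comp_hasDerivAt w hfw.differentiableAt.hasDerivAt).clm_apply
        hgw.differentiableAt.hasDerivAt
      rw [add_comm]
      exact h1.deriv
    rw [hd.iteratedDeriv_eq, iteratedDeriv_add_of_analyticAt (hBan hf hg.deriv)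
      (hBan hf.deriv hg), ih hf hg.deriv, ih hf.deriv hg]
    simp only [iteratedDeriv_succ']
    congr 1
    refine Finset.sum_congr rfl fun ij hij => ?_
    -- The Pascal recursion weights this half of the sum by the binomial coefficient of the second
    -- index.
    rw [Nat.choose_symm_of_eq_add (Finset.HasAntidiagonal.mem_antidiagonal.1 hij).symm]

end Calculus

/-! ### Holomorphy of the exponential and integral operators -/

theorem isOpen_halfPlane (η : ℝ) : IsOpen {z : ℂ | -η < z.re} :=
  isOpen_lt continuous_const Complex.continuous_re

theorem eventually_halfPlane {z : ℂ} (hz : -η < z.re) : ∀ᶠ w in 𝓝 z, -η < w.re :=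
  (isOpen_halfPlane η).mem_nhds hz

open Classical in
/-- `c ↦ e^{z·} c` as an operator `ℂⁿ → BUC_η` for `Re z > -η`. -/
def expCLM (η : ℝ) (n : ℕ) (z : ℂ) : Cn n →L[ℂ] BUC η n :=
  if hz : -η < z.re then
    LinearMap.mkContinuous ⟨⟨expBUC η z, expBUC_add hz⟩, expBUC_smul hz⟩ 1
      fun c => by simpa using norm_expBUC_le hz c
  else 0

open Classical in
/-- `φ ↦ ∫_·^0 e^{z(· - s)} φ(s) ds` as an operator on `BUC_η` for `Re z > -η`. -/
def integralCLM (η : ℝ) (n : ℕ) (z : ℂ) : BUC η n →L[ℂ] BUC η n :=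
  if hz : -η < z.re then
    LinearMap.mkContinuous ⟨⟨expIntegral 0 z, expIntegral_add hz⟩, expIntegral_smul hz⟩
      (z.re + η)⁻¹ fun φ => norm_expIntegral_le hz φ
  else 0

theorem expCLM_apply {z : ℂ} (hz : -η < z.re) (c : Cn n) : expCLM η n z c = expBUC η z c := by
  rw [expCLM, dif_pos hz]; rfl

theorem integralCLM_apply {z : ℂ} (hz : -η < z.re) (φ : BUC η n) :
    integralCLM η n z φ = expIntegral 0 z φ := by
  rw [integralCLM, dif_pos hz]; rfl

theorem norm_integralCLM_le {z : ℂ} (hz : -η < z.re) : ‖integralCLM η n z‖ ≤ (z.re + η)⁻¹ :=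
  ContinuousLinearMap.opNorm_le_bound _ (by have : 0 < z.re + η := by linarith
                                            positivity)
    fun φ => by rw [integralCLM_apply hz]; exact norm_expIntegral_le hz φ

/-- The operator at `z` is the resolvent of differentiation with zero boundary value, and this is
its resolvent identity. The function `χ` obtained at `w` satisfies `χ(0) = 0` and `χ' = zχ - ((z -
w)χ + φ)`, so variation of constants at `z` recovers it. -/
theorem integralCLM_sub {z w : ℂ} (hz : -η < z.re) (hw : -η < w.re) :
    integralCLM η n z - integralCLM η n w =
      (z - w) • -((integralCLM η n z).comp (integralCLM η n w)) := by
  ext1 φ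
  have h := isDeriv_expIntegral hw φ
  have e : w • expIntegral 0 w φ - φ =
      z • expIntegral 0 w φ - ((z - w) • expIntegral 0 w φ + φ) := by rw [sub_smul]; abel
  rw [e] at h
  have h2 := eq_of_isDeriv hz h
  rw [expIntegral_at0 hw, expBUC_zero hz, zero_add, expIntegral_add hz, expIntegral_smul hz] at h2
  simp only [_root_.sub_apply, _root_.smul_apply,
    neg_apply, ContinuousLinearMap.comp_apply, integralCLM_apply hz,
    integralCLM_apply hw]
  rw [smul_neg]
  nth_rewrite 1 [h2]
  abel

/-- Read at `z`, the exponential `e^{w·} c` solves the equation with source `(z - w) e^{w·} c` and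
value `c` at `0`. -/
theorem expCLM_sub {z w : ℂ} (hz : -η < z.re) (hw : -η < w.re) :
    expCLM η n z - expCLM η n w =
      (z - w) • -((integralCLM η n z).comp (expCLM η n w)) := by
  ext1 c
  have h := isDeriv_expBUC hw c
  have e : w • expBUC η w c = z • expBUC η w c - (z - w) • expBUC η w c := by
    rw [sub_smul]; abel
  rw [e] at h
  have h2 := eq_of_isDeriv hz h
  rw [expBUC_at0 hw, expIntegral_smul hz] at h2
  simp only [_root_.sub_apply, _root_.smul_apply,
    neg_apply, ContinuousLinearMap.comp_apply, integralCLM_apply hz,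
    expCLM_apply hz, expCLM_apply hw]
  rw [smul_neg]
  nth_rewrite 1 [h2]
  abel

theorem continuousAt_integralCLM {w : ℂ} (hw : -η < w.re) :
    ContinuousAt (integralCLM η n) w := by
  rw [ContinuousAt, tendsto_iff_norm_sub_tendsto_zero]
  have hlim : Tendsto (fun z : ℂ => ‖z - w‖ * ((z.re + η)⁻¹ * ‖integralCLM η n w‖)) (𝓝 w)
      (𝓝 0) := by
    have : ContinuousAt (fun z : ℂ => ‖z - w‖ * ((z.re + η)⁻¹ * ‖integralCLM η n w‖)) w := by
      refine ContinuousAt.mul (by fun_prop) (ContinuousAt.mul (ContinuousAt.inv₀ ?_ ?_) ?_)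
      · exact (Complex.continuous_re.add continuous_const).continuousAt
      · linarith
      · exact continuousAt_const
    simpa [ContinuousAt] using this
  refine squeeze_zero' (Eventually.of_forall fun _ => norm_nonneg _) ?_ hlim
  filter_upwards [eventually_halfPlane hw] with z hz
  rw [integralCLM_sub hz hw, norm_smul, norm_neg]
  gcongr
  exact (ContinuousLinearMap.opNorm_comp_le _ _).trans
    (mul_le_mul_of_nonneg_right (norm_integralCLM_le hz) (norm_nonneg _))

theorem analyticAt_integralCLM {w : ℂ} (hw : -η < w.re) : AnalyticAt ℂ (integralCLM η n) w := by
  have h : DifferentiableOn ℂ (integralCLM η n) {z | -η < z.re} := fun z hz => by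
    refine (hasDerivAt_of_sub_eq_smul
      (h := fun u => -((integralCLM η n u).comp (integralCLM η n z)))
      ?_ ?_).differentiableAt.differentiableWithinAt
    · filter_upwards [eventually_halfPlane hz] with u hu using integralCLM_sub hu hz
    · exact ((continuousAt_integralCLM hz).clm_comp continuousAt_const).neg
  exact h.analyticAt ((isOpen_halfPlane η).mem_nhds hw)

theorem analyticAt_expCLM {w : ℂ} (hw : -η < w.re) : AnalyticAt ℂ (expCLM η n) w := by
  have h : DifferentiableOn ℂ (expCLM η n) {z | -η < z.re} := fun z hz => by
    refine (hasDerivAt_of_sub_eq_smul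
      (h := fun u => -((integralCLM η n u).comp (expCLM η n z)))
      ?_ ?_).differentiableAt.differentiableWithinAt
    · filter_upwards [eventually_halfPlane hz] with u hu using expCLM_sub hu hz
    · exact ((continuousAt_integralCLM hz).clm_comp continuousAt_const).neg
  exact h.analyticAt ((isOpen_halfPlane η).mem_nhds hw)

theorem analyticAt_expIntegral_zero (φ : BUC η n) {w : ℂ} (hw : -η < w.re) :
    AnalyticAt ℂ (fun z => expIntegral 0 z φ) w := by
  refine (analyticAt_clm_apply (analyticAt_integralCLM hw) (analyticAt_const (v := φ))).congr ?_
  filter_upwards [eventually_halfPlane hw] with z hz using integralCLM_apply hz φ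

theorem hasDerivAt_expIntegral_apply (i : ℕ) (φ : BUC η n) {z : ℂ} (hz : -η < z.re)
    (θ : Iic (0 : ℝ)) :
    HasDerivAt (fun w => expIntegral i w φ θ) (expIntegral (i + 1) z φ θ) z := by
  have hφ := φ.continuous_onReal
  have key := intervalIntegral.hasDerivAt_integral_of_dominated_loc_of_deriv_le
    (μ := MeasureTheory.volume) (a := (θ : ℝ)) (b := 0) (x₀ := z) (s := Metric.ball z 1)
    (F := fun (w : ℂ) s =>
      ((((θ : ℝ) - s : ℝ) : ℂ) ^ i * Complex.exp (w * ((θ : ℝ) - s : ℝ))) • φ.onReal s)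
    (F' := fun (w : ℂ) s =>
      ((((θ : ℝ) - s : ℝ) : ℂ) ^ (i + 1) * Complex.exp (w * ((θ : ℝ) - s : ℝ))) • φ.onReal s)
    -- On the unit ball about `z` one has `|w| ≤ |z| + 1`, and the integration runs over the compact
    -- interval `[θ, 0]`.
    (bound := fun s => |(θ : ℝ) - s| ^ (i + 1) * Real.exp ((‖z‖ + 1) * |(θ : ℝ) - s|) *
      ‖φ.onReal s‖)
    (Metric.ball_mem_nhds z one_pos)
    (Eventually.of_forall fun w => Continuous.aestronglyMeasurable (by fun_prop))
    (Continuous.intervalIntegrable (by fun_prop) _ _)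
    (Continuous.aestronglyMeasurable (by fun_prop))
    (Eventually.of_forall fun s _ w hw => ?_)
    (Continuous.intervalIntegrable (by fun_prop) _ _)
    (Eventually.of_forall fun s _ w _ => ?_)
  · rw [expIntegral_apply _ hz]
    refine key.2.congr_of_eventuallyEq ?_
    filter_upwards [eventually_halfPlane hz] with w hw using expIntegral_apply i hw φ θ
  · rw [norm_smul, norm_mul, norm_pow, Complex.norm_real, Real.norm_eq_abs]
    gcongr
    rw [Complex.norm_exp]
    refine Real.exp_le_exp.2 ?_
    refine (Complex.re_le_norm _).trans ?_
    rw [norm_mul, Complex.norm_real, Real.norm_eq_abs]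
    gcongr
    have := norm_sub_norm_le w z
    rw [mem_ball_iff_norm] at hw
    linarith
  · have h1 : HasDerivAt (fun w : ℂ => w * (((θ : ℝ) - s : ℝ) : ℂ)) (((θ : ℝ) - s : ℝ) : ℂ) w := by
      simpa using (hasDerivAt_id w).mul_const (((θ : ℝ) - s : ℝ) : ℂ)
    refine ((h1.cexp.const_mul _).smul_const (φ.onReal s)).congr_deriv ?_
    congr 1
    ring

/-- Differentiability in the norm of `BUC_η` is already known for `i = 0` and passes to all
derivatives. It therefore suffices to identify them pointwise, where differentiation under the
integral adds one factor `θ - s` at a time. -/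
theorem iteratedDeriv_expIntegral (φ : BUC η n) (i : ℕ) :
    ∀ {z : ℂ}, -η < z.re → iteratedDeriv i (fun w => expIntegral 0 w φ) z = expIntegral i z φ := by
  induction i with
  | zero => intro z _; simp
  | succ i ih =>
    intro z hz
    refine BUC.ext fun θ => ?_
    have hEq : iteratedDeriv i (fun w => expIntegral 0 w φ) =ᶠ[𝓝 z]
        fun w => expIntegral i w φ := by
      filter_upwards [eventually_halfPlane hz] with w hw using ih hw
    have han : AnalyticAt ℂ (fun w => expIntegral i w φ) z :=
      ((analyticAt_expIntegral_zero φ hz).iterated_deriv i).congr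
        (by rw [← iteratedDeriv_eq_iterate]; exact hEq)
    rw [iteratedDeriv_succ, hEq.deriv_eq]
    have h1 := (evalCLM η n θ).hasFDerivAt.comp_hasDerivAt z han.differentiableAt.hasDerivAt
    exact h1.unique (hasDerivAt_expIntegral_apply i φ hz θ)

/-! ### The bracket `b(z)` and the derivatives of `L₀²` -/

variable (Lhat : BUC η n →L[ℂ] Cn n)

/-- `(α, φ) ↦ α + φ(0) + L̂(∫_·^0 e^{z(· - s)} φ(s) ds)` as an operator. -/
def bracketCLM (z : ℂ) : State η n →L[ℂ] Cn n :=
  ContinuousLinearMap.fst ℂ (Cn n) (BUC η n) +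
    (evalCLM η n ⟨0, self_mem_Iic⟩ + Lhat.comp (integralCLM η n z)).comp
      (ContinuousLinearMap.snd ℂ (Cn n) (BUC η n))

variable {Lhat}

theorem bracketCLM_apply {z : ℂ} (hz : -η < z.re) (x : State η n) :
    bracketCLM Lhat z x = bracket Lhat x z := by
  simp [bracketCLM, bracket, integralCLM_apply hz, at0_eq, add_assoc]

theorem analyticAt_bracketCLM {z : ℂ} (hz : -η < z.re) : AnalyticAt ℂ (bracketCLM Lhat) z := by
  exact analyticAt_const.add (analyticAt_clm_comp (analyticAt_const.add
    (analyticAt_clm_comp analyticAt_const (analyticAt_integralCLM hz))) analyticAt_const)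

theorem analyticAt_bracket (x : State η n) {z : ℂ} (hz : -η < z.re) :
    AnalyticAt ℂ (bracket Lhat x) z := by
  refine (analyticAt_clm_apply (analyticAt_bracketCLM (Lhat := Lhat) hz)
    (analyticAt_const (v := x))).congr ?_
  filter_upwards [eventually_halfPlane hz] with w hw using bracketCLM_apply hw x

theorem analyticAt_Ltwo (x : State η n) {z : ℂ} (hz : -η < z.re) :
    AnalyticAt ℂ (Ltwo Lhat x) z := by
  refine (analyticAt_clm_apply (analyticAt_expCLM hz) (analyticAt_bracket (Lhat := Lhat) x hz)).congr ?_
  filter_upwards [eventually_halfPlane hz] with w hw using expCLM_apply hw _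

theorem iteratedDeriv_bracket (x : State η n) {z : ℂ} (hz : -η < z.re) {i : ℕ} (hi : 1 ≤ i) :
    iteratedDeriv i (bracket Lhat x) z = Lhat (expIntegral i z x.2) := by
  have h := iteratedDeriv_add_of_analyticAt (analyticAt_const (𝕜 := ℂ) (v := x.1 + at0 x.2))
    ((Lhat.analyticAt _).comp (analyticAt_expIntegral_zero x.2 hz)) i
  have h2 := iteratedDeriv_clm_comp Lhat (analyticAt_expIntegral_zero x.2 hz) i
  rw [iteratedDeriv_expIntegral x.2 i hz] at h2
  rw [iteratedDeriv_const, if_neg (by omega), zero_add] at h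
  exact h.trans h2

/-- Evaluation at `θ` commutes with differentiation in `z` and leaves the product `e^{θz} b(z)`, to
which Leibniz' rule applies. -/
theorem iteratedDeriv_Ltwo_apply (x : State η n) {z : ℂ} (hz : -η < z.re) (j : ℕ)
    (θ : Iic (0 : ℝ)) : iteratedDeriv j (Ltwo Lhat x) z θ =
      ∑ k ∈ Finset.range (j + 1), ((j.choose k : ℂ) * ((θ : ℝ) : ℂ) ^ k *
        Complex.exp (z * (θ : ℝ))) • iteratedDeriv (j - k) (bracket Lhat x) z := by
  have h1 := iteratedDeriv_clm_comp (evalCLM η n θ) (analyticAt_Ltwo (Lhat := Lhat) x hz) j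
  have h2 : (fun w => evalCLM η n θ (Ltwo Lhat x w)) =ᶠ[𝓝 z]
      fun w => ContinuousLinearMap.lsmul ℂ ℂ (Complex.exp (((θ : ℝ) : ℂ) * w))
        (bracket Lhat x w) := by
    filter_upwards [eventually_halfPlane hz] with w hw
    rw [evalCLM_apply, Ltwo, expBUC_apply hw, ContinuousLinearMap.lsmul_apply, mul_comm]
  rw [h2.iteratedDeriv_eq, iteratedDeriv_bilinear _ (by fun_prop)
    (analyticAt_bracket x hz), evalCLM_apply] at h1
  rw [← h1, Finset.Nat.sum_antidiagonal_eq_sum_range_succ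
    (fun a b => j.choose a • ContinuousLinearMap.lsmul ℂ ℂ
      (iteratedDeriv a (fun w => Complex.exp (((θ : ℝ) : ℂ) * w)) z)
      (iteratedDeriv b (bracket Lhat x) z))]
  refine Finset.sum_congr rfl fun k _ => ?_
  rw [ContinuousLinearMap.lsmul_apply, iteratedDeriv_cexp_const_mul, ← Nat.cast_smul_eq_nsmul ℂ,
    smul_smul, mul_comm z, mul_assoc]

/-! ### The graph of `A + L` -/

theorem mem_graph_iff {x y : State η n} : (x, y) ∈ (opA η n + opL Lhat).graph ↔
    x.1 = 0 ∧ IsDeriv x.2 y.2 ∧ y.1 = Lhat x.2 - at0 y.2 := by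
  obtain ⟨a, φ⟩ := x
  obtain ⟨α, χ⟩ := y
  rw [LinearPMap.mem_graph_iff]
  have key : ∀ w : (opA η n + opL Lhat).domain, (opA η n + opL Lhat) w =
      (Lhat (w : State η n).2 - at0 (deriv ⟨(w : State η n).2, w.2.1.2⟩),
        deriv ⟨(w : State η n).2, w.2.1.2⟩) := by
    intro w
    rw [LinearPMap.add_apply]
    refine Prod.ext ?_ ?_
    · change -(at0 (deriv ⟨(w : State η n).2, w.2.1.2⟩)) + Lhat (w : State η n).2 = _
      exact neg_add_eq_sub _ _
    · change deriv ⟨(w : State η n).2, w.2.1.2⟩ + 0 = _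
      rw [add_zero]
  constructor
  · rintro ⟨w, hw, hy⟩
    rw [key] at hy
    obtain ⟨h1, h2⟩ := Prod.ext_iff.1 hy
    have hw1 : (w : State η n).1 = a := congrArg Prod.fst hw
    have hw2 : (w : State η n).2 = φ := congrArg Prod.snd hw
    have hd := isDeriv_deriv ⟨(w : State η n).2, w.2.1.2⟩
    simp only at h1 h2 hd
    rw [h2, hw2] at hd
    refine ⟨?_, hd, ?_⟩
    · rw [← hw1]
      exact w.2.1.1
    · rw [← hw2]
      simp only
      rw [← h1, h2]
  · rintro ⟨h1, h2, h3⟩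
    simp only at h1 h2 h3
    refine ⟨⟨(a, φ), ⟨⟨h1, h2.mem⟩, ⟨h1, trivial⟩⟩⟩, rfl, ?_⟩
    rw [key]
    simp only
    rw [h2.deriv_eq, ← h3]

/-! ### Resolvents of unbounded operators -/

section Resolvent

variable {X : Type*} [NormedAddCommGroup X] [NormedSpace ℂ X] {B : X →ₗ.[ℂ] X} {z : ℂ}
  {R : X →L[ℂ] X}

theorem isResolventAt_iff : IsResolventAt B z R ↔
    (∀ x : X, (R x, z • R x - x) ∈ B.graph) ∧ ∀ x y, (x, y) ∈ B.graph → R (z • x - y) = x := by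
  refine and_congr_right fun _ => ⟨fun h x y hxy => ?_, fun h x => h _ _ (B.mem_graph x)⟩
  obtain ⟨w, hw, hy⟩ := (LinearPMap.mem_graph_iff B).1 hxy
  simp only at hw hy
  rw [← hw, ← hy, h w]

/-- A single resolvent operator encodes the whole graph. Membership becomes an equation between
bounded operators, which can be expanded in Taylor series although `B` is unbounded. -/
theorem IsResolventAt.mem_graph_iff (h : IsResolventAt B z R) {x y : X} :
    (x, y) ∈ B.graph ↔ R (z • x - y) = x := by
  rw [isResolventAt_iff] at h
  refine ⟨h.2 x y, fun hxy => ?_⟩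
  have := h.1 (z • x - y)
  rwa [hxy, sub_sub_cancel] at this

theorem IsResolventAt.unique {R' : X →L[ℂ] X} (h : IsResolventAt B z R)
    (h' : IsResolventAt B z R') : R = R' := by
  ext x
  have := (isResolventAt_iff.1 h').2 _ _ (h.1 x)
  rw [sub_sub_cancel] at this
  exact this.symm

theorem IsResolventAt.resolvent_eq (h : IsResolventAt B z R) : resolvent B z = R := by
  have h' : ∃ R, IsResolventAt B z R := ⟨R, h⟩
  rw [resolvent, dif_pos h']
  exact h'.choose_spec.unique h

end Resolvent

/-! ### The resolvent of `A + L` through `Δ(z)⁻¹` -/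

variable (Lhat)

/-- `Δ(z)` as an operator. -/
def deltaCLM (z : ℂ) : Cn n →L[ℂ] Cn n :=
  z • ContinuousLinearMap.id ℂ (Cn n) - Lhat.comp (expCLM η n z)

variable {Lhat}

theorem deltaCLM_apply {z : ℂ} (hz : -η < z.re) (c : Cn n) :
    deltaCLM Lhat z c = z • c - Lhat (expBUC η z c) := by
  simp [deltaCLM, expCLM_apply hz]

theorem toEuclideanCLM_Delta {z : ℂ} (hz : -η < z.re) :
    Matrix.toEuclideanCLM (𝕜 := ℂ) (Delta Lhat z) = deltaCLM Lhat z := by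
  refine ContinuousLinearMap.coe_injective
    ((EuclideanSpace.basisFun (Fin n) ℂ).toBasis.ext fun j => ?_)
  simp only [OrthonormalBasis.coe_toBasis, EuclideanSpace.basisFun_apply,
    ContinuousLinearMap.coe_coe]
  rw [deltaCLM_apply hz]
  ext i
  rw [EuclideanSpace.single, Matrix.toEuclideanCLM_toLp]
  simp [Delta, Matrix.one_apply, EuclideanSpace.single]

theorem deltaCLM_comp_DeltaInv {z : ℂ} (hz : -η < z.re) (hd : (Delta Lhat z).det ≠ 0) :
    deltaCLM Lhat z * DeltaInv Lhat z = 1 := by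
  rw [← toEuclideanCLM_Delta hz, DeltaInv, ← map_mul, Matrix.mul_nonsing_inv _ hd.isUnit, map_one]

theorem DeltaInv_comp_deltaCLM {z : ℂ} (hz : -η < z.re) (hd : (Delta Lhat z).det ≠ 0) :
    DeltaInv Lhat z * deltaCLM Lhat z = 1 := by
  rw [← toEuclideanCLM_Delta hz, DeltaInv, ← map_mul, Matrix.nonsing_inv_mul _ hd.isUnit, map_one]

theorem det_Delta_ne_zero_of_isUnit {z : ℂ} (hz : -η < z.re) (h : IsUnit (deltaCLM Lhat z)) :
    (Delta Lhat z).det ≠ 0 := by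
  rw [← toEuclideanCLM_Delta hz] at h
  have h2 : IsUnit (Delta Lhat z) := by
    have := h.map (Matrix.toEuclideanCLM (n := Fin n) (𝕜 := ℂ)).symm
    rwa [StarAlgEquiv.symm_apply_apply] at this
  exact ((Matrix.isUnit_iff_isUnit_det _).1 h2).ne_zero

variable (Lhat)

/-- The formula for the resolvent of `A + L` in terms of an inverse `D` of `Δ(z)`. -/
def resolventFormula (z : ℂ) (D : Cn n →L[ℂ] Cn n) : State η n →L[ℂ] State η n :=
  (ContinuousLinearMap.inr ℂ (Cn n) (BUC η n)).comp
    ((expCLM η n z).comp (D.comp (bracketCLM Lhat z)) +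
      (integralCLM η n z).comp (ContinuousLinearMap.snd ℂ (Cn n) (BUC η n)))

variable {Lhat}

theorem resolventFormula_apply {z : ℂ} (hz : -η < z.re) (D : Cn n →L[ℂ] Cn n) (x : State η n) :
    resolventFormula Lhat z D x =
      (0, expBUC η z (D (bracket Lhat x z)) + expIntegral 0 z x.2) := by
  simp [resolventFormula, bracketCLM_apply hz, expCLM_apply hz, integralCLM_apply hz]

/-- The second component of the resolvent equation is solved by variation of constants with `c =
φ(0)` free, and the first component is exactly `Δ(z) c = b(z)`. -/
theorem isResolventAt_resolventFormula {z : ℂ} (hz : -η < z.re)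
    (hd : (Delta Lhat z).det ≠ 0) :
    IsResolventAt (opA η n + opL Lhat) z (resolventFormula Lhat z (DeltaInv Lhat z)) := by
  have hr : ∀ c, deltaCLM Lhat z (DeltaInv Lhat z c) = c := fun c =>
    congrArg (fun T => T c) (deltaCLM_comp_DeltaInv hz hd)
  have hl : ∀ c, DeltaInv Lhat z (deltaCLM Lhat z c) = c := fun c =>
    congrArg (fun T => T c) (DeltaInv_comp_deltaCLM hz hd)
  rw [isResolventAt_iff]
  constructor
  · intro x
    rw [resolventFormula_apply hz, mem_graph_iff]
    set c := DeltaInv Lhat z (bracket Lhat x z) with hc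
    refine ⟨rfl, ?_, ?_⟩
    · have h := (isDeriv_expBUC hz c).add (isDeriv_expIntegral hz x.2)
      have e : z • expBUC η z c + (z • expIntegral 0 z x.2 - x.2) =
        z • (expBUC η z c + expIntegral 0 z x.2) - x.2 := by rw [smul_add]; abel
      rwa [e] at h
    · have h := hr (bracket Lhat x z)
      rw [← hc, deltaCLM_apply hz, bracket] at h
      simp only [Prod.fst_sub, Prod.smul_mk, smul_zero, Prod.snd_sub, map_sub, map_add, map_smul,
        expBUC_at0 hz, expIntegral_at0 hz]
      rw [add_zero, zero_sub, neg_eq_iff_add_eq_zero, ← sub_eq_zero.2 h.symm]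
      module
  · rintro ⟨a, φ⟩ ⟨α, χ⟩ hxy
    obtain ⟨h1, h2, h3⟩ := mem_graph_iff.1 hxy
    simp only at h1 h2 h3
    have hφ : φ = expBUC η z (at0 φ) + expIntegral 0 z (z • φ - χ) :=
      eq_of_isDeriv hz (by rwa [sub_sub_cancel])
    rw [resolventFormula_apply hz]
    -- Substituting the variation of constants formula into `L̂ φ` cancels the integral term of the
    -- bracket and leaves `Δ(z) φ(0)`.
    have hb : bracket Lhat (z • (a, φ) - (α, χ)) z = deltaCLM Lhat z (at0 φ) := by
      have hL := congrArg Lhat hφ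
      rw [map_add] at hL
      rw [deltaCLM_apply hz, bracket]
      simp only [Prod.fst_sub, Prod.smul_mk, Prod.snd_sub, map_sub, map_smul, h1, smul_zero, h3]
      rw [hL, ← sub_eq_zero]
      module
    rw [hb, hl, h1]
    exact Prod.ext rfl hφ.symm

/-! ### Meromorphy of `Δ⁻¹` -/

theorem analyticAt_deltaCLM {z : ℂ} (hz : -η < z.re) : AnalyticAt ℂ (deltaCLM Lhat) z := by
  refine AnalyticAt.sub ?_ (analyticAt_clm_comp analyticAt_const (analyticAt_expCLM hz))
  exact analyticAt_id.smul analyticAt_const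

theorem analyticAt_Delta_entry {z : ℂ} (hz : -η < z.re) (i j : Fin n) :
    AnalyticAt ℂ (fun w => Delta Lhat w i j) z := by
  have h : (fun w => Delta Lhat w i j) =ᶠ[𝓝 z] fun w =>
      (EuclideanSpace.proj i : Cn n →L[ℂ] ℂ) (deltaCLM Lhat w (EuclideanSpace.single j 1)) := by
    filter_upwards [eventually_halfPlane hz] with w hw
    rw [deltaCLM_apply hw]
    simp [Delta, Matrix.one_apply]
  exact (analyticAt_clm_apply analyticAt_const
    (analyticAt_clm_apply (analyticAt_deltaCLM hz) analyticAt_const)).congr h.symm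

theorem analyticAt_det {m : Type*} [Fintype m] [DecidableEq m] {M : ℂ → Matrix m m ℂ} {z : ℂ}
    (h : ∀ i j, AnalyticAt ℂ (fun w => M w i j) z) : AnalyticAt ℂ (fun w => (M w).det) z := by
  simp only [Matrix.det_apply']
  exact Finset.analyticAt_fun_sum _ fun σ _ =>
    analyticAt_const.mul (Finset.analyticAt_fun_prod _ fun i _ => h _ _)

theorem analyticAt_adjugate_apply {m : Type*} [Fintype m] [DecidableEq m] {M : ℂ → Matrix m m ℂ}
    {z : ℂ} (h : ∀ i j, AnalyticAt ℂ (fun w => M w i j) z) (i j : m) :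
    AnalyticAt ℂ (fun w => (M w).adjugate i j) z := by
  simp only [Matrix.adjugate_apply]
  refine analyticAt_det fun k l => ?_
  simp only [Matrix.updateRow_apply]
  split_ifs
  · exact analyticAt_const
  · exact h k l

theorem meromorphicAt_DeltaInv {z : ℂ} (hz : -η < z.re) : MeromorphicAt (DeltaInv Lhat) z := by
  have hadj : AnalyticAt ℂ (fun w =>
      Matrix.toEuclideanCLM (𝕜 := ℂ) (Delta Lhat w).adjugate) z := by
    have e : (fun w => Matrix.toEuclideanCLM (𝕜 := ℂ) (Delta Lhat w).adjugate) = fun w =>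
        ∑ i, ∑ j, (Delta Lhat w).adjugate i j •
          Matrix.toEuclideanCLM (𝕜 := ℂ) (Matrix.single i j (1 : ℂ)) := by
      funext w
      conv_lhs => rw [Matrix.matrix_eq_sum_single (Delta Lhat w).adjugate]
      simp only [map_sum, ← map_smul, Matrix.smul_single, smul_eq_mul, mul_one]
    rw [e]
    exact Finset.analyticAt_fun_sum _ fun i _ => Finset.analyticAt_fun_sum _ fun j _ =>
      (analyticAt_adjugate_apply (fun i j => analyticAt_Delta_entry hz i j) i j).smul
        analyticAt_const
  -- Cramer's rule. It holds also where the determinant vanishes, both sides being `0` there by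
  -- convention.
  have e : DeltaInv Lhat = fun w => ((Delta Lhat w).det)⁻¹ •
      Matrix.toEuclideanCLM (𝕜 := ℂ) (Delta Lhat w).adjugate := by
    funext w
    rw [DeltaInv, Matrix.inv_def, map_smul, Ring.inverse_eq_inv']
  rw [e]
  exact (analyticAt_det fun i j => analyticAt_Delta_entry hz i j).meromorphicAt.inv.smul
    hadj.meromorphicAt

/-- For real `r > -η` with `r > ‖L̂‖` one has `‖L̂(e^{r·} c)‖ ≤ ‖L̂‖ ‖c‖ < r ‖c‖` for `c ≠ 0`, so
`Δ(r)` is injective, hence invertible in finite dimension. -/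
theorem exists_det_Delta_ne_zero : ∃ z : ℂ, -η < z.re ∧ (Delta Lhat z).det ≠ 0 := by
  set r : ℝ := max (-η) ‖Lhat‖ + 1 with hr
  have hr0 : ‖Lhat‖ < r := by linarith [le_max_right (-η) ‖Lhat‖]
  have hz : -η < ((r : ℂ)).re := by
    rw [Complex.ofReal_re]
    linarith [le_max_left (-η) ‖Lhat‖]
  refine ⟨r, hz, det_Delta_ne_zero_of_isUnit hz ?_⟩
  have hpos : 0 < r := (norm_nonneg _).trans_lt hr0
  rw [ContinuousLinearMap.isUnit_iff_bijective]
  have hinj : Function.Injective (deltaCLM Lhat (r : ℂ)) := by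
    refine (injective_iff_map_eq_zero _).2 fun c hc => ?_
    rw [deltaCLM_apply hz, sub_eq_zero] at hc
    have h1 := Lhat.le_opNorm_of_le (norm_expBUC_le hz c)
    rw [← hc, norm_smul, Complex.norm_real, Real.norm_eq_abs, abs_of_pos hpos] at h1
    by_contra hne
    have := norm_pos_iff.2 hne
    nlinarith
  exact ⟨hinj, (LinearMap.injective_iff_surjective
    (f := (deltaCLM Lhat (r : ℂ) : Cn n →ₗ[ℂ] Cn n))).1 hinj⟩

/-- By the identity theorem on the connected half-plane, a non-isolated zero would make `det Δ`
vanish identically. -/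
theorem eventually_det_Delta_ne_zero {z₀ : ℂ} (hz : -η < z₀.re) :
    ∀ᶠ z in 𝓝[≠] z₀, (Delta Lhat z).det ≠ 0 := by
  have han : AnalyticOnNhd ℂ (fun w => (Delta Lhat w).det) {z | -η < z.re} := fun w hw =>
    analyticAt_det fun i j => analyticAt_Delta_entry hw i j
  rcases (han z₀ hz).eventually_eq_zero_or_eventually_ne_zero with h | h
  · obtain ⟨w, hw, hne⟩ := exists_det_Delta_ne_zero (Lhat := Lhat)
    exact absurd (han.eqOn_zero_of_preconnected_of_eventuallyEq_zero
      (convex_halfSpace_re_gt (-η)).isPreconnected hz h hw) hne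
  · exact h

/-! ### Taylor and Laurent coefficients -/

section Taylor

variable {E F : Type*} [NormedAddCommGroup E] [NormedSpace ℂ E] [NormedAddCommGroup F]
  [NormedSpace ℂ F]

/-- The coefficient of `(z - z₀)ʲ` in the Taylor expansion of `g` at `z₀`. -/
def taylorCoeff (g : ℂ → E) (z₀ : ℂ) (j : ℕ) : E := (j.factorial : ℂ)⁻¹ • iteratedDeriv j g z₀

/-- The coefficient of `(z - z₀)ʲ` in the Laurent expansion of `(z - z₀)⁻ᵏ g(z)` at `z₀`. -/
def laurentCoeff (g : ℂ → E) (z₀ : ℂ) (k : ℕ) (j : ℤ) : E :=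
  if j < -(k : ℤ) then 0 else taylorCoeff g z₀ (j + k).toNat

variable {f g : ℂ → E} {z₀ : ℂ}

@[simp] theorem taylorCoeff_zero_eq : taylorCoeff g z₀ 0 = g z₀ := by simp [taylorCoeff]

theorem taylorCoeff_congr (hfg : f =ᶠ[𝓝 z₀] g) (j : ℕ) :
    taylorCoeff f z₀ j = taylorCoeff g z₀ j := by
  rw [taylorCoeff, taylorCoeff, hfg.iteratedDeriv_eq]

theorem taylorCoeff_const_zero (j : ℕ) : taylorCoeff (fun _ => (0 : E)) z₀ j = 0 := by
  simp [taylorCoeff]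

theorem laurentCoeff_sub (k m : ℕ) :
    laurentCoeff g z₀ k ((m : ℤ) - k) = taylorCoeff g z₀ m := by
  rw [laurentCoeff, if_neg (by omega), sub_add_cancel, Int.toNat_natCast]

theorem laurentCoeff_neg_of_le {k j : ℕ} (hj : j ≤ k) :
    laurentCoeff g z₀ k (-(j : ℤ)) = taylorCoeff g z₀ (k - j) := by
  rw [← laurentCoeff_sub k (k - j), Nat.cast_sub hj, sub_sub_cancel_left]

theorem laurentCoeff_neg_order (k : ℕ) : laurentCoeff g z₀ k (-(k : ℤ)) = g z₀ := by
  rw [laurentCoeff_neg_of_le le_rfl, Nat.sub_self, taylorCoeff_zero_eq]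

theorem taylorCoeff_sub_smul_zero : taylorCoeff (fun z => (z - z₀) • g z) z₀ 0 = 0 := by simp

theorem eventuallyEq_pow_smul {k : ℕ}
    (hf : ∀ᶠ z in 𝓝[≠] z₀, f z = (z - z₀) ^ (-(k : ℤ)) • g z) :
    (fun z => (z - z₀) ^ k • f z) =ᶠ[𝓝[≠] z₀] g := by
  filter_upwards [hf, self_mem_nhdsWithin] with z hz hne
  have hne' : z - z₀ ≠ 0 := sub_ne_zero.2 hne
  rw [hz, smul_smul, ← zpow_natCast, ← zpow_add₀ hne', add_neg_cancel, zpow_zero, one_smul]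

/-- A nonzero limit means meromorphic order `0`, and orders add under multiplication by `(z - z₀)ᵏ`.
-/
theorem eq_of_tendsto_zpow_smul {p : ℤ} (hf : MeromorphicAt f z₀)
    (hp : meromorphicOrderAt f z₀ = ((-p : ℤ) : WithTop ℤ)) {k : ℤ} {M : E} (hM : M ≠ 0)
    (h : Tendsto (fun z => (z - z₀) ^ k • f z) (𝓝[≠] z₀) (𝓝 M)) : k = p := by
  have hz : MeromorphicAt (fun z : ℂ => (z - z₀) ^ k) z₀ :=
    (MeromorphicAt.sub (MeromorphicAt.id z₀) (MeromorphicAt.const z₀ z₀)).zpow k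
  have h1 := (tendsto_ne_zero_iff_meromorphicOrderAt_eq_zero (hz.smul hf)).1 ⟨M, hM, h⟩
  rw [meromorphicOrderAt_smul hz hf, hp, fun_meromorphicOrderAt_zpow_id_sub_const,
    ← WithTop.coe_add, ← WithTop.coe_zero, WithTop.coe_inj] at h1
  omega

variable [CompleteSpace E]

theorem taylorCoeff_add (hf : AnalyticAt ℂ f z₀) (hg : AnalyticAt ℂ g z₀) (j : ℕ) :
    taylorCoeff (fun z => f z + g z) z₀ j = taylorCoeff f z₀ j + taylorCoeff g z₀ j := by
  rw [taylorCoeff, iteratedDeriv_add_of_analyticAt hf hg, smul_add]; rfl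

theorem taylorCoeff_clm (L : E →L[ℂ] F) (hf : AnalyticAt ℂ f z₀) (j : ℕ) :
    taylorCoeff (fun z => L (f z)) z₀ j = L (taylorCoeff f z₀ j) := by
  rw [taylorCoeff, iteratedDeriv_clm_comp L hf, taylorCoeff, map_smul]

theorem iteratedDeriv_sub_const_self (i : ℕ) :
    iteratedDeriv i (fun z : ℂ => z - z₀) z₀ = if i = 1 then 1 else 0 := by
  rcases i with _ | i
  · simp
  · rw [iteratedDeriv_succ']
    have : _root_.deriv (fun z : ℂ => z - z₀) = fun _ => 1 := by
      funext z
      simp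
    rw [this, iteratedDeriv_const]
    simp

/-- In the Leibniz sum only the first derivative of `z - z₀` is nonzero at `z₀`; its binomial factor
`j + 1` is absorbed by the factorial. -/
theorem taylorCoeff_sub_smul_succ (hg : AnalyticAt ℂ g z₀) (j : ℕ) :
    taylorCoeff (fun z => (z - z₀) • g z) z₀ (j + 1) = taylorCoeff g z₀ j := by
  have h := iteratedDeriv_bilinear (ContinuousLinearMap.lsmul ℂ ℂ)
    (f := fun z : ℂ => z - z₀) (by fun_prop) hg (j + 1)
  simp only [ContinuousLinearMap.lsmul_apply] at h
  rw [taylorCoeff, h, Finset.sum_eq_single (1, j)]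
  · simp only [iteratedDeriv_sub_const_self, if_true, one_smul, Nat.choose_one_right]
    rw [← Nat.cast_smul_eq_nsmul ℂ, smul_smul, Nat.factorial_succ, taylorCoeff]
    congr 1
    push_cast
    have h1 : (j : ℂ) + 1 ≠ 0 := Nat.cast_add_one_ne_zero j
    field_simp
  · rintro ⟨a, b⟩ hab hne
    rw [iteratedDeriv_sub_const_self, if_neg, zero_smul, smul_zero]
    rintro rfl
    have := Finset.HasAntidiagonal.mem_antidiagonal.1 hab
    simp only at this
    exact hne (by rw [show b = j by omega])
  · intro hn
    exact absurd (Finset.HasAntidiagonal.mem_antidiagonal.2 (by simp only; omega)) hn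

theorem taylorCoeff_pow_smul (hg : AnalyticAt ℂ g z₀) (k j : ℕ) :
    taylorCoeff (fun z => (z - z₀) ^ k • g z) z₀ j =
      if j < k then 0 else taylorCoeff g z₀ (j - k) := by
  induction k generalizing j with
  | zero => simp
  | succ k ih =>
    have han : AnalyticAt ℂ (fun z => (z - z₀) ^ k • g z) z₀ :=
      AnalyticAt.fun_smul (by fun_prop) hg
    simp only [pow_succ', mul_smul]
    rcases j with _ | j
    · rw [taylorCoeff_sub_smul_zero, if_pos (Nat.succ_pos k)]
    · rw [taylorCoeff_sub_smul_succ han, ih, Nat.add_sub_add_right]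
      simp only [Nat.add_lt_add_iff_right]

theorem taylorCoeff_pow_smul_const (x : E) (k j : ℕ) :
    taylorCoeff (fun z => (z - z₀) ^ k • x) z₀ j = if j = k then x else 0 := by
  rw [taylorCoeff_pow_smul analyticAt_const]
  rcases lt_trichotomy j k with hjk | rfl | hjk
  · rw [if_pos hjk, if_neg hjk.ne]
  · simp
  · rw [if_neg hjk.not_gt, if_neg hjk.ne', taylorCoeff, iteratedDeriv_const,
      if_neg (Nat.sub_ne_zero_of_lt hjk), smul_zero]

theorem taylorCoeff_bilinear [CompleteSpace F] {G : Type*} [NormedAddCommGroup G] [NormedSpace ℂ G]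
    [CompleteSpace G] (B : E →L[ℂ] F →L[ℂ] G) {f : ℂ → E} {g : ℂ → F}
    (hf : AnalyticAt ℂ f z₀) (hg : AnalyticAt ℂ g z₀) (m : ℕ) :
    taylorCoeff (fun z => B (f z) (g z)) z₀ m =
      ∑ j ∈ Finset.range (m + 1), B (taylorCoeff f z₀ (m - j)) (taylorCoeff g z₀ j) := by
  rw [taylorCoeff, iteratedDeriv_bilinear B hf hg, Finset.smul_sum,
    ← Finset.Nat.sum_antidiagonal_swap, Finset.Nat.sum_antidiagonal_eq_sum_range_succ_mk]
  refine Finset.sum_congr rfl fun j hj => ?_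
  have hj' : j ≤ m := Nat.lt_succ_iff.1 (Finset.mem_range.1 hj)
  simp only [Prod.swap_prod_mk, taylorCoeff, map_smul, _root_.smul_apply, smul_smul,
    ← Nat.cast_smul_eq_nsmul ℂ]
  congr 1
  rw [Nat.choose_symm hj', Nat.cast_choose ℂ hj']
  have h1 : (m.factorial : ℂ) ≠ 0 := Nat.cast_ne_zero.2 m.factorial_ne_zero
  have h2 : (j.factorial : ℂ) ≠ 0 := Nat.cast_ne_zero.2 j.factorial_ne_zero
  have h3 : ((m - j).factorial : ℂ) ≠ 0 := Nat.cast_ne_zero.2 (m - j).factorial_ne_zero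
  field_simp

theorem eventually_hasSum_taylorCoeff (hg : AnalyticAt ℂ g z₀) :
    ∀ᶠ z in 𝓝 z₀, HasSum (fun m : ℕ => (z - z₀) ^ m • taylorCoeff g z₀ m) (g z) := by
  obtain ⟨r, hr, hd⟩ := Metric.eventually_nhds_iff_ball.1 hg.eventually_analyticAt
  filter_upwards [Metric.ball_mem_nhds z₀ hr] with z hz
  have := Complex.hasSum_taylorSeries_on_ball
    (fun w hw => (hd w hw).differentiableAt.differentiableWithinAt) hz
  convert this using 2 with m
  exact smul_comm _ _ _

theorem hasLaurentExpansionAt_of_eventually_eq {k : ℕ} (hg : AnalyticAt ℂ g z₀)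
    (hf : ∀ᶠ z in 𝓝[≠] z₀, f z = (z - z₀) ^ (-(k : ℤ)) • g z) :
    HasLaurentExpansionAt f z₀ k (laurentCoeff g z₀ k) := by
  refine ⟨fun j hj => if_pos hj, ?_⟩
  filter_upwards [hf, (eventually_hasSum_taylorCoeff hg).filter_mono nhdsWithin_le_nhds,
    self_mem_nhdsWithin] with z hz hs hne
  rw [hz]
  have h := hs.const_smul ((z - z₀) ^ (-(k : ℤ)))
  have hne' : z - z₀ ≠ 0 := sub_ne_zero.2 hne
  convert h using 2 with m
  rw [laurentCoeff_sub, smul_smul, ← zpow_natCast, ← zpow_add₀ hne', neg_add_eq_sub]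

/-- Laurent coefficients as limits of derivatives. -/
theorem tendsto_iteratedDeriv_pow_smul {k : ℕ} (hg : AnalyticAt ℂ g z₀)
    (hf : ∀ᶠ z in 𝓝[≠] z₀, f z = (z - z₀) ^ (-(k : ℤ)) • g z) (m : ℕ) :
    Tendsto (fun z => (m.factorial : ℂ)⁻¹ •
      iteratedDeriv m (fun w => (w - z₀) ^ k • f w) z) (𝓝[≠] z₀) (𝓝 (taylorCoeff g z₀ m)) := by
  have hc : ContinuousAt (fun z => (m.factorial : ℂ)⁻¹ • iteratedDeriv m g z) z₀ := by
    have := (hg.iterated_deriv m).continuousAt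
    rw [← iteratedDeriv_eq_iterate] at this
    exact this.const_smul _
  refine (hc.tendsto.mono_left nhdsWithin_le_nhds).congr' ?_
  -- The two functions may differ at `z₀`, but near every other nearby point they agree on a full
  -- neighbourhood, so their derivatives agree there.
  have h1 := eventually_eventually_nhdsWithin.2 (eventuallyEq_pow_smul hf)
  filter_upwards [h1, self_mem_nhdsWithin] with z hz hne
  rw [IsOpen.nhdsWithin_eq isOpen_compl_singleton hne] at hz
  have hz' : (fun z => (z - z₀) ^ k • f z) =ᶠ[𝓝 z] g := hz
  rw [hz'.iteratedDeriv_eq]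

end Taylor

/-! ### The residue of a resolvent at a pole -/

section Projector

variable {X : Type*} [NormedAddCommGroup X] [NormedSpace ℂ X] [CompleteSpace X]
  {B : X →ₗ.[ℂ] X} {z₀ : ℂ} {k : ℕ} {G : ℂ → X →L[ℂ] X}

theorem taylorCoeff_clm_apply (hG : AnalyticAt ℂ G z₀) (x : X) (j : ℕ) :
    taylorCoeff (fun z => G z x) z₀ j = taylorCoeff G z₀ j x :=
  taylorCoeff_clm (ContinuousLinearMap.apply ℂ X x) hG j

theorem eventually_eq_of_punctured {E : Type*} [NormedAddCommGroup E] [NormedSpace ℂ E]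
    {f g : ℂ → E} (hf : AnalyticAt ℂ f z₀) (hg : AnalyticAt ℂ g z₀)
    (h : ∀ᶠ z in 𝓝[≠] z₀, f z = g z) : f =ᶠ[𝓝 z₀] g :=
  (hf.frequently_eq_iff_eventually_eq hg).1 h.frequently

/-- With `y = (z₀ - B)x` one has `(z - B)x = (z - z₀)x + y`. Applying `G(z) = (z - z₀)ᵏ (z - B)⁻¹`
gives `(z - z₀)G(z)x + G(z)y = (z - z₀)ᵏ x`, and the coefficients of order `j + 1` are compared. -/
theorem taylorCoeff_resolvent_left (hG : AnalyticAt ℂ G z₀)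
    (hR : ∀ᶠ z in 𝓝[≠] z₀, IsResolventAt B z ((z - z₀) ^ (-(k : ℤ)) • G z)) {x y : X}
    (hxy : (x, z₀ • x - y) ∈ B.graph) (j : ℕ) :
    taylorCoeff G z₀ j x + taylorCoeff G z₀ (j + 1) y = if j + 1 = k then x else 0 := by
  have hGx : ∀ x, AnalyticAt ℂ (fun z => G z x) z₀ := fun x =>
    analyticAt_clm_apply hG analyticAt_const
  have hGx' : AnalyticAt ℂ (fun z => (z - z₀) • G z x) z₀ :=
    AnalyticAt.fun_smul (by fun_prop) (hGx x)
  have hpow : AnalyticAt ℂ (fun z => (z - z₀) ^ k • x) z₀ :=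
    AnalyticAt.fun_smul (by fun_prop) analyticAt_const
  have hEq : (fun z => (z - z₀) • G z x + G z y) =ᶠ[𝓝 z₀] fun z => (z - z₀) ^ k • x := by
    refine eventually_eq_of_punctured (hGx'.add (hGx y)) hpow ?_
    filter_upwards [hR, self_mem_nhdsWithin] with z hz hne
    have hne' : z - z₀ ≠ 0 := sub_ne_zero.2 hne
    have h1 := (isResolventAt_iff.1 hz).2 _ _ hxy
    have e : z • x - (z₀ • x - y) = (z - z₀) • x + y := by rw [sub_smul]; abel
    rw [e, _root_.smul_apply, map_add, map_smul] at h1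
    rw [← zpow_natCast, ← smul_right_injective X (zpow_ne_zero (-(k : ℤ)) hne') |>.eq_iff, h1,
      smul_smul, ← zpow_add₀ hne', neg_add_cancel, zpow_zero, one_smul]
  have h2 := taylorCoeff_congr hEq (j + 1)
  rwa [taylorCoeff_add hGx' (hGx y), taylorCoeff_sub_smul_succ (hGx x),
    taylorCoeff_clm_apply hG, taylorCoeff_clm_apply hG, taylorCoeff_pow_smul_const] at h2

/-- This expands `(z - B)G(z)x = (z - z₀)ᵏ x`, whose right-hand side has no coefficient of order `j
< k`. Using the coefficient of `(z - z₀)G(z)x`, which is `0` for `j = 0`, covers the end of the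
chain as well. -/
theorem taylorCoeff_resolvent_right (hG : AnalyticAt ℂ G z₀)
    (hR : ∀ᶠ z in 𝓝[≠] z₀, IsResolventAt B z ((z - z₀) ^ (-(k : ℤ)) • G z)) (x : X) {j : ℕ}
    (hj : j < k) :
    (taylorCoeff G z₀ j x,
      z₀ • taylorCoeff G z₀ j x + taylorCoeff (fun z => (z - z₀) • G z x) z₀ j) ∈ B.graph := by
  obtain ⟨z₁, hz₁⟩ := hR.exists
  set R := (z₁ - z₀) ^ (-(k : ℤ)) • G z₁
  have hGx : AnalyticAt ℂ (fun z => G z x) z₀ := analyticAt_clm_apply hG analyticAt_const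
  have hGx' : AnalyticAt ℂ (fun z => (z - z₀) • G z x) z₀ :=
    AnalyticAt.fun_smul (by fun_prop) hGx
  have hpow : AnalyticAt ℂ (fun z => (z - z₀) ^ k • x) z₀ :=
    AnalyticAt.fun_smul (by fun_prop) analyticAt_const
  have han : ∀ L : X →L[ℂ] X, ∀ {f : ℂ → X}, AnalyticAt ℂ f z₀ →
      AnalyticAt ℂ (fun z => L (f z)) z₀ := fun L _ hf => analyticAt_clm_apply analyticAt_const hf
  -- Graph membership is rewritten with the bounded resolvent at a fixed `z₁`, splitting `z₁ - z =
  -- (z₁ - z₀) - (z - z₀)`, so that coefficients can be taken termwise.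
  have hEq : (fun z => (((z₁ - z₀) • R) (G z x) + (-R) ((z - z₀) • G z x)) +
      R ((z - z₀) ^ k • x)) =ᶠ[𝓝 z₀] fun z => G z x := by
    refine eventually_eq_of_punctured
      (((han _ hGx).fun_add (han _ hGx')).fun_add (han _ hpow)) hGx ?_
    filter_upwards [hR, self_mem_nhdsWithin] with z hz hne
    have hne' : z - z₀ ≠ 0 := sub_ne_zero.2 hne
    have h1 := hz.1 ((z - z₀) ^ k • x)
    have e : ((z - z₀) ^ (-(k : ℤ)) • G z) ((z - z₀) ^ k • x) = G z x := by
      rw [_root_.smul_apply, map_smul, smul_smul, ← zpow_natCast, ← zpow_add₀ hne',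
        neg_add_cancel, zpow_zero, one_smul]
    rw [e, hz₁.mem_graph_iff] at h1
    nth_rewrite 3 [← h1]
    simp only [_root_.smul_apply, neg_apply, map_sub, map_smul]
    module
  have h2 := taylorCoeff_congr hEq j
  rw [taylorCoeff_add ((han _ hGx).fun_add (han _ hGx')) (han _ hpow),
    taylorCoeff_add (han _ hGx) (han _ hGx'), taylorCoeff_clm _ hGx, taylorCoeff_clm _ hGx',
    taylorCoeff_clm _ hpow, taylorCoeff_pow_smul_const, if_neg hj.ne, map_zero, add_zero,
    taylorCoeff_clm_apply hG] at h2
  rw [hz₁.mem_graph_iff]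
  nth_rewrite 3 [← h2]
  simp only [_root_.smul_apply, neg_apply, map_sub, map_add, map_smul]
  module

/-- The chain ends at `0`, so walking it backwards shows that the coefficients of order `≥ k`, the
regular part of the resolvent, vanish along it. The relation of order `k - 1` at the start then
reads `B₋₁ x = x`. -/
theorem taylorCoeff_apply_of_mem_generalizedEigenspace (hG : AnalyticAt ℂ G z₀)
    (hR : ∀ᶠ z in 𝓝[≠] z₀, IsResolventAt B z ((z - z₀) ^ (-(k : ℤ)) • G z)) (hk : 1 ≤ k)
    {x : X} (hx : x ∈ generalizedEigenspace B z₀) : taylorCoeff G z₀ (k - 1) x = x := by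
  obtain ⟨m, y, rfl, hm, hy⟩ := hx
  have hrel : ∀ i < m, ∀ j, taylorCoeff G z₀ j (y i) + taylorCoeff G z₀ (j + 1) (y (i + 1)) =
      if j + 1 = k then y i else 0 := fun i hi j => taylorCoeff_resolvent_left hG hR (hy i hi) j
  have hzero : ∀ d i, i + d = m → ∀ j, k ≤ j → taylorCoeff G z₀ j (y i) = 0 := by
    intro d
    induction d with
    | zero =>
      rintro i rfl j _
      rw [add_zero] at hm
      rw [hm, map_zero]
    | succ d ih =>
      intro i hi j hj
      have h1 := hrel i (by omega) j
      rwa [ih (i + 1) (by omega) (j + 1) (by omega), add_zero, if_neg (by omega)] at h1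
  rcases m with _ | m
  · rw [hm, map_zero]
  · have h1 := hrel 0 (Nat.succ_pos m) (k - 1)
    rwa [Nat.sub_add_cancel hk, if_pos rfl, hzero m (0 + 1) (by omega) k le_rfl, add_zero] at h1

theorem taylorCoeff_mem_generalizedEigenspace (hG : AnalyticAt ℂ G z₀)
    (hR : ∀ᶠ z in 𝓝[≠] z₀, IsResolventAt B z ((z - z₀) ^ (-(k : ℤ)) • G z)) (hk : 1 ≤ k)
    (x : X) : taylorCoeff G z₀ (k - 1) x ∈ generalizedEigenspace B z₀ := by
  have hGx : AnalyticAt ℂ (fun z => G z x) z₀ := analyticAt_clm_apply hG analyticAt_const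
  -- Since `(z₀ - B)` sends the coefficient of order `j < k` to minus the preceding one, the chain
  -- runs down from order `k - 1` with alternating signs and reaches `0` after `k` steps.
  refine ⟨k, fun i => if i < k then (-1 : ℂ) ^ i • taylorCoeff G z₀ (k - 1 - i) x else 0, ?_, ?_,
    fun i hi => ?_⟩
  · simp [show 0 < k by omega]
  · simp
  · have h := B.graph.smul_mem ((-1 : ℂ) ^ i)
      (taylorCoeff_resolvent_right hG hR x (j := k - 1 - i) (by omega))
    convert h using 1
    simp only [if_pos hi, Prod.smul_mk, Prod.mk.injEq, true_and]
    split_ifs with hi'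
    · rw [show k - 1 - i = (k - 1 - (i + 1)) + 1 by omega, taylorCoeff_sub_smul_succ hGx,
        taylorCoeff_clm_apply hG, pow_succ, smul_add, smul_comm]
      simp
    · rw [show k - 1 - i = 0 by omega, taylorCoeff_sub_smul_zero, add_zero, sub_zero, smul_comm]

end Projector

/-! ### Lower bounds for the essential norm -/

section EssentialNorm

variable {X : Type*} [NormedAddCommGroup X] [NormedSpace ℂ X]

/-- An operator that is bounded below on an infinite-dimensional subspace has a positive essential
norm. -/
theorem exists_mul_le_essNorm {N : Submodule ℂ X} (hN : ¬FiniteDimensional ℂ N) :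
    ∃ δ > 0, ∀ (T : X →L[ℂ] X) (c : ℝ), (∀ x ∈ N, c * ‖x‖ ≤ ‖T x‖) → δ * c ≤ essNorm T := by
  -- Riesz's lemma gives a `1`-separated sequence of norm at most `R`. Scaled into the unit ball it
  -- has images `c/R`-separated, and two of them share a ball of radius `ε`, so `c/R ≤ 2ε`; this is
  -- the origin of `δ = 1/(2R)`.
  obtain ⟨R, f, hR, hfR, hf⟩ := exists_seq_norm_le_one_le_norm_sub hN
  have hR0 : 0 < R := one_pos.trans hR
  refine ⟨(2 * R)⁻¹, by positivity, fun T c hT => ?_⟩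
  rcases le_or_gt c 0 with hc | hc
  · refine (mul_nonpos_of_nonneg_of_nonpos (by positivity) hc).trans ?_
    exact Real.sInf_nonneg fun ε hε => hε.1.le
  -- An admissible radius must be exhibited, because the infimum of an empty set of reals is `0`.
  refine le_csInf ⟨‖T‖ + 1, by positivity, {0}, finite_singleton 0, ?_⟩ ?_
  · rintro _ ⟨x, hx, rfl⟩
    simp only [mem_singleton_iff, iUnion_iUnion_eq_left, mem_closedBall_zero_iff] at hx ⊢
    have := T.le_of_opNorm_le_of_le le_rfl hx
    linarith
  · rintro ε ⟨hε, F, hF, hcov⟩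
    have hv : ∀ k, ∃ p ∈ F, T (((R⁻¹ : ℝ) : ℂ) • (f k : X)) ∈ Metric.closedBall p ε := by
      intro k
      have h1 : T (((R⁻¹ : ℝ) : ℂ) • (f k : X)) ∈ T '' Metric.closedBall 0 1 := by
        refine ⟨_, ?_, rfl⟩
        rw [mem_closedBall_zero_iff, norm_smul, Complex.norm_real, Real.norm_eq_abs,
          abs_of_pos (inv_pos.2 hR0), inv_mul_le_iff₀ hR0, mul_one]
        exact hfR k
      simpa using hcov h1
    choose p hpF hp using hv
    obtain ⟨k, -, m, -, hkm, hpe⟩ :=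
      infinite_univ.exists_ne_map_eq_of_mapsTo (f := p) (fun k _ => hpF k) hF
    have h1 : dist (T (((R⁻¹ : ℝ) : ℂ) • (f k : X))) (T (((R⁻¹ : ℝ) : ℂ) • (f m : X))) ≤ ε + ε :=
      (dist_triangle_right _ _ (p k)).trans (add_le_add (hp k) (by rw [hpe]; exact hp m))
    rw [dist_eq_norm, ← map_sub, ← smul_sub] at h1
    have h2 := hT (((R⁻¹ : ℝ) : ℂ) • ((f k : X) - f m)) (N.smul_mem _ (f k - f m).2)
    have h3 : 1 ≤ ‖(f k : X) - f m‖ := hf hkm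
    rw [norm_smul, Complex.norm_real, Real.norm_eq_abs, abs_of_pos (inv_pos.2 hR0)] at h2
    have h4 : R⁻¹ ≤ R⁻¹ * ‖(f k : X) - f m‖ := le_mul_of_one_le_right (by positivity) h3
    have h5 : c * R⁻¹ ≤ c * (R⁻¹ * ‖(f k : X) - f m‖) := mul_le_mul_of_nonneg_left h4 hc.le
    have e : (2 * R)⁻¹ * c = c * R⁻¹ / 2 := by field_simp
    rw [e]
    linarith

/-- The constant disappears in the limit because `log δ / t` tends to `0`. -/
theorem le_essGrowthRate {T : ℝ≥0 → X →L[ℂ] X} {δ a : ℝ} (hδ : 0 < δ)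
    (h : ∀ t : ℝ≥0, δ * Real.exp (a * t) ≤ essNorm (T t)) : (a : EReal) ≤ essGrowthRate T := by
  have hlim : Tendsto (fun t : ℝ≥0 => ((Real.log δ / t + a : ℝ) : EReal)) atTop (𝓝 (a : EReal)) := by
    rw [EReal.tendsto_coe]
    have h1 : Tendsto (fun t : ℝ≥0 => (t : ℝ)) atTop atTop := NNReal.tendsto_coe_atTop.2 tendsto_id
    simpa using (h1.const_div_atTop (Real.log δ)).add_const a
  rw [← hlim.limsup_eq, essGrowthRate]
  refine limsup_le_limsup ?_
  filter_upwards [eventually_gt_atTop 0] with t ht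
  have ht' : 0 < (t : ℝ) := ht
  have hpos : 0 < δ * Real.exp (a * t) := by positivity
  have h2 : ((Real.log δ / t + a : ℝ) : EReal) =
      ENNReal.log (ENNReal.ofReal (δ * Real.exp (a * t))) / ((t : ℝ) : EReal) := by
    rw [ENNReal.log_ofReal, if_neg (not_le.2 hpos), Real.log_mul hδ.ne' (Real.exp_pos _).ne',
      Real.log_exp, ← EReal.coe_div]
    congr 1
    field_simp
  rw [h2]
  exact EReal.div_le_div_right_of_nonneg (EReal.coe_nonneg.2 ht'.le)
    (ENNReal.log_monotone (ENNReal.ofReal_le_ofReal (h t)))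

end EssentialNorm

/-! ### Orbits of strongly continuous semigroups -/

section Semigroup

variable {X : Type*} [NormedAddCommGroup X] [NormedSpace ℂ X] {B : X →ₗ.[ℂ] X}
  {T : ℝ≥0 → X →L[ℂ] X}

theorem IsC0Semigroup.tendsto_quotient (hT : IsC0Semigroup T) (hB : IsGenerator B T) {x y : X}
    (hxy : (x, y) ∈ B.graph) (t : ℝ≥0) :
    Tendsto (fun h : ℝ≥0 => (((h : ℝ) : ℂ))⁻¹ • (T (t + h) x - T t x)) (𝓝[>] 0) (𝓝 (T t y)) := by
  refine (((T t).continuous.tendsto y).comp ((hB x y).1 hxy)).congr fun h => ?_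
  rw [Function.comp_apply, map_smul, map_sub, hT.map_add]
  rfl

theorem IsC0Semigroup.map_mem_graph (hT : IsC0Semigroup T) (hB : IsGenerator B T) {x y : X}
    (hxy : (x, y) ∈ B.graph) (t : ℝ≥0) : (T t x, T t y) ∈ B.graph := by
  refine (hB _ _).2 ((hT.tendsto_quotient hB hxy t).congr fun h => ?_)
  rw [add_comm, hT.map_add]
  rfl

theorem IsC0Semigroup.tendsto_slope (hT : IsC0Semigroup T) (hB : IsGenerator B T) {x y : X}
    (hxy : (x, y) ∈ B.graph) {s : ℝ} (hs : 0 ≤ s) :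
    Tendsto (fun r : ℝ => (((r - s : ℝ) : ℂ))⁻¹ • (T r.toNNReal x - T s.toNNReal x)) (𝓝[>] s)
      (𝓝 (T s.toNNReal y)) := by
  have h1 : Tendsto (fun r : ℝ => (r - s).toNNReal) (𝓝[>] s) (𝓝[>] 0) := by
    refine tendsto_nhdsWithin_iff.2 ⟨?_, ?_⟩
    · have : Continuous fun r : ℝ => (r - s).toNNReal := by fun_prop
      simpa using (this.tendsto s).mono_left nhdsWithin_le_nhds
    · filter_upwards [self_mem_nhdsWithin] with r hr
      exact Real.toNNReal_pos.2 (sub_pos.2 hr)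
  refine ((hT.tendsto_quotient hB hxy s.toNNReal).comp h1).congr' ?_
  filter_upwards [self_mem_nhdsWithin] with r hr
  have hr' : 0 ≤ r - s := (sub_pos.2 hr).le
  rw [Function.comp_apply, ← Real.toNNReal_add hs hr', add_sub_cancel, Real.coe_toNNReal _ hr']

end Semigroup

/-- The restricted relation is single-valued because the graph of `B` is, so passing to a partial
linear map does not change it. -/
theorem mem_graph_partInClosure {X : Type*} [NormedAddCommGroup X] [NormedSpace ℂ X]
    {B : X →ₗ.[ℂ] X} {x y : B.domain.topologicalClosure} :
    (x, y) ∈ (partInClosure B).graph ↔ ((x : X), (y : X)) ∈ B.graph := by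
  rw [partInClosure, Submodule.toLinearPMap_graph_eq]
  · rfl
  · rintro ⟨x, y⟩ hxy hx
    simp only at hx
    subst hx
    exact Subtype.ext (B.graph_fst_eq_zero_snd hxy rfl)

/-- Joint continuity is needed because both the state and the evaluation point move along `s ↦
(T(s)x)(p - s)`. -/
theorem continuous_onReal_uncurry : Continuous fun p : BUC η n × ℝ => p.1.onReal p.2 := by
  rw [continuous_iff_continuousAt]
  rintro ⟨φ, r⟩
  rw [ContinuousAt, tendsto_iff_norm_sub_tendsto_zero]
  have hlim : Tendsto (fun p : BUC η n × ℝ => Real.exp (-(η * min 0 p.2)) * ‖p.1 - φ‖ +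
      ‖φ.onReal p.2 - φ.onReal r‖) (𝓝 (φ, r)) (𝓝 0) := by
    have h1 := φ.continuous_onReal
    have : Continuous fun p : BUC η n × ℝ => Real.exp (-(η * min 0 p.2)) * ‖p.1 - φ‖ +
      ‖φ.onReal p.2 - φ.onReal r‖ := by fun_prop
    simpa using this.tendsto (φ, r)
  refine squeeze_zero (fun _ => norm_nonneg _) (fun p => ?_) hlim
  have h1 := (p.1 - φ).norm_apply_le ⟨min 0 p.2, mem_Iic.2 (min_le_left _ _)⟩
  have h2 : (p.1 - φ) ⟨min 0 p.2, mem_Iic.2 (min_le_left _ _)⟩ = p.1.onReal p.2 - φ.onReal p.2 :=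
    rfl
  rw [h2] at h1
  have h3 := norm_add_le (p.1.onReal p.2 - φ.onReal p.2) (φ.onReal p.2 - φ.onReal r)
  rw [sub_add_sub_cancel] at h3
  linarith

/-! ### The semigroup acts by translation -/

section Shift

variable {T : ℝ≥0 → (opA η n + opL Lhat).domain.topologicalClosure →L[ℂ]
    (opA η n + opL Lhat).domain.topologicalClosure}

/-- On the domain of the generator the semigroup acts as a translation as long as `t + θ ≤ 0`. -/
theorem semigroup_apply_eq_translate (hT : IsC0Semigroup T)
    (hgen : IsGenerator (partInClosure (opA η n + opL Lhat)) T)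
    {x y : (opA η n + opL Lhat).domain.topologicalClosure}
    (hxy : ((x : State η n), (y : State η n)) ∈ (opA η n + opL Lhat).graph) (t : ℝ≥0) {p : ℝ}
    (hp : p ≤ 0) : (T t x : State η n).2.onReal (p - t) = (x : State η n).2.onReal p := by
  rw [← mem_graph_partInClosure] at hxy
  -- This function has zero right derivative: moving the state contributes `χ(p - s)` with `χ` the
  -- derivative of `T(s)x`, and moving the point contributes `-χ(p - s)`. A continuous function with
  -- zero right derivative is constant.
  set g : ℝ → Cn n := fun s => (T s.toNNReal x : State η n).2.onReal (p - s) with hg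
  have hTc : Continuous fun s : ℝ => (T s.toNNReal x : State η n).2 :=
    continuous_snd.comp (continuous_subtype_val.comp
      ((hT.continuous x).comp continuous_real_toNNReal))
  have hgc : Continuous g := continuous_onReal_uncurry.comp
    (hTc.prodMk (continuous_const.sub continuous_id))
  have key := constant_of_has_deriv_right_zero (a := 0) (b := t) hgc.continuousOn
    (fun s hs => ?_) t ⟨t.2, le_rfl⟩
  · simpa [hg, hT.map_zero] using key
  · rw [← hasDerivWithinAt_Ioi_iff_Ici, hasDerivWithinAt_iff_tendsto_slope' (by simp)]
    set χ := (T s.toNNReal y : State η n).2 with hχ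
    have hd : IsDeriv (T s.toNNReal x : State η n).2 χ :=
      (mem_graph_iff.1 (mem_graph_partInClosure.1 (hT.map_mem_graph hgen hxy s.toNNReal))).2.1
    have h1 : Tendsto (fun r : ℝ => (((r - s : ℝ) : ℂ))⁻¹ •
        ((T r.toNNReal x : State η n).2 - (T s.toNNReal x : State η n).2)) (𝓝[>] s) (𝓝 χ) :=
      ((continuous_snd.comp continuous_subtype_val).tendsto _).comp
        (hT.tendsto_slope hgen hxy hs.1)
    have h2 : Tendsto (fun r : ℝ => p - r) (𝓝[>] s) (𝓝 (p - s)) :=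
      ((continuous_const.sub continuous_id).tendsto s).mono_left nhdsWithin_le_nhds
    have h3 := (continuous_onReal_uncurry.tendsto (χ, p - s)).comp (h1.prodMk_nhds h2)
    have hps : p - s ≤ 0 := by linarith [hs.1]
    have h4 : HasDerivWithinAt (fun r => (T s.toNNReal x : State η n).2.onReal (p - r))
        ((-1 : ℝ) • χ.onReal (p - s)) (Ioi s) s :=
      HasDerivWithinAt.scomp (h := fun r => p - r) s (hd (p - s) hps)
        (((hasDerivAt_id s).const_sub p).hasDerivWithinAt) fun r hr => by
          have : s < r := hr
          simp only [mem_Iic]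
          linarith
    rw [hasDerivWithinAt_iff_tendsto_slope' (by simp)] at h4
    have h5 := h3.add h4
    simp only [neg_smul, one_smul, add_neg_cancel] at h5
    refine h5.congr fun r => ?_
    simp only [Function.comp_apply, slope_def_module, hg]
    have e : ((((r - s : ℝ) : ℂ))⁻¹ • ((T r.toNNReal x : State η n).2 -
        (T s.toNNReal x : State η n).2)).onReal (p - r) =
        (((r - s : ℝ) : ℂ))⁻¹ • ((T r.toNNReal x : State η n).2.onReal (p - r) -
          (T s.toNNReal x : State η n).2.onReal (p - r)) := rfl
    rw [e, ← Complex.ofReal_inv, Complex.coe_smul, ← smul_add, sub_add_sub_cancel]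

/-- Every value of `x` reappears in `T(t)x` shifted left by `t`, which changes its weight by
`e^{-ηt}`. Domain elements have zero first component, so their norm is that of `BUC_η`. -/
theorem exp_mul_norm_le_norm_semigroup (hT : IsC0Semigroup T)
    (hgen : IsGenerator (partInClosure (opA η n + opL Lhat)) T)
    {x y : (opA η n + opL Lhat).domain.topologicalClosure}
    (hxy : ((x : State η n), (y : State η n)) ∈ (opA η n + opL Lhat).graph) (t : ℝ≥0) :
    Real.exp (-η * t) * ‖x‖ ≤ ‖T t x‖ := by
  have h1 : ‖x‖ = ‖(x : State η n).2‖ := by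
    rw [Submodule.coe_norm, Prod.norm_def, (mem_graph_iff.1 hxy).1, norm_zero,
      max_eq_right (norm_nonneg _)]
  have h2 : ‖(T t x : State η n).2‖ ≤ ‖T t x‖ := norm_snd_le (T t x : State η n)
  have h3 : ‖(x : State η n).2‖ ≤ Real.exp (η * t) * ‖T t x‖ := by
    refine norm_le _ fun θ => ?_
    have hθ : (θ : ℝ) ≤ 0 := θ.2
    have ht : (0 : ℝ) ≤ t := t.2
    have hθt : (θ : ℝ) - t ≤ 0 := by linarith
    rw [← onReal_coe, ← semigroup_apply_eq_translate hT hgen hxy t hθ, onReal_of_le _ hθt]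
    have h4 := (T t x : State η n).2.norm_apply_le ⟨(θ : ℝ) - t, hθt⟩
    calc _ ≤ Real.exp (η * θ) * (Real.exp (-(η * (θ - t))) * ‖T t x‖) := by
          gcongr
          exact h4.trans (by gcongr)
      _ = _ := by
        rw [← mul_assoc, ← Real.exp_add]
        ring_nf
  rw [h1]
  calc _ ≤ Real.exp (-η * t) * (Real.exp (η * t) * ‖T t x‖) := by gcongr
    _ = _ := by
      rw [← mul_assoc, ← Real.exp_add, neg_mul, neg_add_cancel, Real.exp_zero, one_mul]

end Shift

/-! ### An infinite-dimensional subspace of the domain -/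

section Exponentials

/-- Exponents in the half-plane `Re z > -η`. -/
def exponent (η : ℝ) (k : ℕ) : ℂ := ((-η + 1 + k : ℝ) : ℂ)

theorem exponent_re (η : ℝ) (k : ℕ) : -η < (exponent η k).re := by
  rw [exponent, Complex.ofReal_re]
  have : (0 : ℝ) ≤ k := k.cast_nonneg
  linarith

/-- Linear combinations of `zₖⁱ e^{zₖ ·} c`. -/
def expComb (η : ℝ) {n : ℕ} (c : Cn n) (i : ℕ) : (ℕ →₀ ℂ) →ₗ[ℂ] BUC η n :=
  Finsupp.linearCombination ℂ fun k => exponent η k ^ i • expBUC η (exponent η k) c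

theorem isDeriv_expComb (c : Cn n) (i : ℕ) (a : ℕ →₀ ℂ) :
    IsDeriv (expComb η c i a) (expComb η c (i + 1) a) := by
  induction a using Finsupp.induction_linear with
  | zero =>
    rw [map_zero, map_zero]
    simpa using (isDeriv_expBUC (exponent_re η 0) c).smul 0
  | add f g hf hg =>
    rw [map_add, map_add]
    exact hf.add hg
  | single k b =>
    simp only [expComb, Finsupp.linearCombination_single]
    have h := ((isDeriv_expBUC (exponent_re η k) c).smul (exponent η k ^ i)).smul b
    rwa [smul_smul (exponent η k ^ i), ← pow_succ] at h

/-- The inclusion of `BUC_η` into the space of all functions. -/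
def coeLM (η : ℝ) (n : ℕ) : BUC η n →ₗ[ℂ] Iic (0 : ℝ) → Cn n :=
  ⟨⟨toFun, fun _ _ => rfl⟩, fun _ _ => rfl⟩

/-- The exponentials are eigenvectors of the shift `θ ↦ θ - 1` with eigenvalues `e^{-zₖ}`, distinct
because the exponents are distinct reals. -/
theorem injective_expComb {c : Cn n} (hc : c ≠ 0) : Function.Injective (expComb η c 0) := by
  have hli : LinearIndependent ℂ fun k => exponent η k ^ 0 • expBUC η (exponent η k) c := by
    refine LinearIndependent.of_comp (coeLM η n) ?_
    refine Module.End.eigenvectors_linearIndependent' (LinearMap.funLeft ℂ (Cn n)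
        fun θ : Iic (0 : ℝ) =>
          (⟨(θ : ℝ) - 1, by have := θ.2; simp only [mem_Iic] at this ⊢; linarith⟩ : Iic (0 : ℝ)))
      (fun k => Complex.exp (-exponent η k)) ?_ _ fun k => ?_
    · intro k m hkm
      simp only [exponent, ← Complex.ofReal_neg, ← Complex.ofReal_exp, Complex.ofReal_inj,
        Real.exp_eq_exp] at hkm
      have : (k : ℝ) = m := by linarith
      exact_mod_cast this
    · have happ : ∀ θ, (coeLM η n)
          (exponent η k ^ 0 • expBUC η (exponent η k) c) θ =
          Complex.exp (exponent η k * (θ : ℝ)) • c := fun θ => by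
        rw [pow_zero, one_smul]
        exact expBUC_apply (exponent_re η k) c θ
      refine Module.End.hasEigenvector_iff.2 ⟨Module.End.mem_eigenspace_iff.2 ?_, fun h0 => ?_⟩
      · funext θ
        rw [LinearMap.funLeft_apply, Function.comp_apply, Pi.smul_apply, happ, happ, smul_smul,
          ← Complex.exp_add]
        congr 2
        push_cast
        ring
      · have h1 := happ ⟨0, self_mem_Iic⟩
        rw [Function.comp_apply] at h0
        rw [h0] at h1
        simp only [Pi.zero_apply, Complex.ofReal_zero, mul_zero, Complex.exp_zero, one_smul] at h1
        exact hc h1.symm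
  exact hli

variable (Lhat)

theorem expComb_mem_graph (c : Cn n) (i : ℕ) (a : ℕ →₀ ℂ) :
    (((0 : Cn n), expComb η c i a), (Lhat (expComb η c i a) - at0 (expComb η c (i + 1) a),
      expComb η c (i + 1) a)) ∈ (opA η n + opL Lhat).graph :=
  mem_graph_iff.2 ⟨rfl, isDeriv_expComb c i a, rfl⟩

/-- The linear combinations of exponentials as elements of the closure of the domain. -/
def expCombClosure (c : Cn n) (i : ℕ) :
    (ℕ →₀ ℂ) →ₗ[ℂ] (opA η n + opL Lhat).domain.topologicalClosure :=
  LinearMap.codRestrict _ (LinearMap.inr ℂ (Cn n) (BUC η n) ∘ₗ expComb η c i) fun a =>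
    Submodule.le_topologicalClosure _ (LinearPMap.mem_domain_of_mem_graph
      (expComb_mem_graph Lhat c i a))

/-- The domain of the part of `A + L` contains an infinite-dimensional space of linear
combinations of exponentials. -/
theorem exists_infinite_dimensional_domain (hn : 0 < n) :
    ∃ N : Submodule ℂ (opA η n + opL Lhat).domain.topologicalClosure,
      ¬FiniteDimensional ℂ N ∧ ∀ x ∈ N, ∃ y : (opA η n + opL Lhat).domain.topologicalClosure,
        ((x : State η n), (y : State η n)) ∈ (opA η n + opL Lhat).graph := by
  set c : Cn n := EuclideanSpace.single ⟨0, hn⟩ 1 with hc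
  have hc0 : c ≠ 0 := by
    exact fun h => one_ne_zero ((PiLp.single_eq_zero_iff 2 _).1 h)
  -- `Λ` is the first component of `(A + L)(0, φ)`; it must vanish for the image to stay in the
  -- closure of the domain. Its values lie in `ℂⁿ`, so its kernel has finite codimension and remains
  -- infinite-dimensional.
  set Λ : (ℕ →₀ ℂ) →ₗ[ℂ] Cn n :=
    (Lhat : BUC η n →ₗ[ℂ] Cn n) ∘ₗ expComb η c 0 - at0 ∘ₗ expComb η c 1 with hΛ
  have hinj : Function.Injective (expCombClosure Lhat c 0) := fun a b hab =>
    injective_expComb hc0 (congrArg Prod.snd (congrArg Subtype.val hab))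
  refine ⟨(LinearMap.ker Λ).map (expCombClosure Lhat c 0), fun hfin => ?_, ?_⟩
  · have e := Submodule.equivMapOfInjective (expCombClosure Lhat c 0) hinj (LinearMap.ker Λ)
    have h1 : Module.Finite ℂ (LinearMap.ker Λ) := Module.Finite.equiv e.symm
    have h2 : Module.Finite ℂ ((ℕ →₀ ℂ) ⧸ LinearMap.ker Λ) :=
      Module.Finite.equiv Λ.quotKerEquivRange.symm
    have h3 : Module.Finite ℂ (ℕ →₀ ℂ) := Module.Finite.of_submodule_quotient (LinearMap.ker Λ)
    have h4 : Finite ℕ := Module.Finite.finite_basis (Finsupp.basisSingleOne (R := ℂ) (ι := ℕ))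
    exact not_finite_iff_infinite.2 inferInstance h4
  · rintro _ ⟨a, ha, rfl⟩
    refine ⟨expCombClosure Lhat c 1 a, ?_⟩
    have h := expComb_mem_graph Lhat c 0 a
    have hz : Lhat (expComb η c 0 a) - at0 (expComb η c (0 + 1) a) = 0 := ha
    rw [hz] at h
    exact h

variable {Lhat}

/-- The estimate holds for every semigroup generated by the part, so the existence of one is not
needed for the infimum. -/
theorem neg_le_essGrowthBound (hn : 0 < n) :
    ((-η : ℝ) : EReal) ≤ essGrowthBound (partInClosure (opA η n + opL Lhat)) := by
  refine le_iInf fun T => le_iInf fun hT => le_iInf fun hgen => ?_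
  obtain ⟨N, hN, hdom⟩ := exists_infinite_dimensional_domain Lhat hn
  obtain ⟨δ, hδ, h⟩ := exists_mul_le_essNorm hN
  refine le_essGrowthRate hδ fun t => h (T t) _ fun x hx => ?_
  obtain ⟨y, hxy⟩ := hdom x hx
  exact exp_mul_norm_le_norm_semigroup hT hgen hxy t

end Exponentials

/-! ### Spectral points are poles of `Δ⁻¹` -/

theorem pos_of_mem_spectrum {z : ℂ} (hz : z ∈ spectrum (opA η n + opL Lhat)) : 0 < n := by
  rcases Nat.eq_zero_or_pos n with rfl | h
  -- For `n = 0` the whole space is trivial and the zero operator is a resolvent at every point.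
  · have : Subsingleton (BUC η 0) := ⟨fun φ ψ => BUC.ext fun θ => Subsingleton.elim _ _⟩
    refine absurd ⟨0, ?_⟩ hz
    rw [isResolventAt_iff]
    refine ⟨fun x => ?_, fun _ _ _ => Subsingleton.elim _ _⟩
    rw [Subsingleton.elim x 0]
    simp
  · exact h

variable {lam₀ : ℂ}

theorem neg_lt_re_of_mem_spectrum (hspec : lam₀ ∈ spectrum (opA η n + opL Lhat))
    (hre : -η < lam₀.re ∨
      essGrowthBound (partInClosure (opA η n + opL Lhat)) < (lam₀.re : EReal)) :
    -η < lam₀.re := by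
  refine hre.elim id fun h => ?_
  exact EReal.coe_lt_coe_iff.1 ((neg_le_essGrowthBound (pos_of_mem_spectrum hspec)).trans_lt h)

theorem det_Delta_eq_zero_of_mem_spectrum (hspec : lam₀ ∈ spectrum (opA η n + opL Lhat))
    (hz : -η < lam₀.re) : (Delta Lhat lam₀).det = 0 := by
  by_contra h
  exact hspec ⟨_, isResolventAt_resolventFormula hz h⟩

/-- `Δ⁻¹` has a pole at the zeros of `det Δ`. -/
theorem exists_pole_DeltaInv (hz : -η < lam₀.re) (hdet : (Delta Lhat lam₀).det = 0) :
    ∃ (k₀ : ℕ) (g : ℂ → Cn n →L[ℂ] Cn n), 1 ≤ k₀ ∧ AnalyticAt ℂ g lam₀ ∧ g lam₀ ≠ 0 ∧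
      meromorphicOrderAt (DeltaInv Lhat) lam₀ = ((-(k₀ : ℤ) : ℤ) : WithTop ℤ) ∧
      ∀ᶠ z in 𝓝[≠] lam₀, DeltaInv Lhat z = (z - lam₀) ^ (-(k₀ : ℤ)) • g z := by
  have hmer := meromorphicAt_DeltaInv (Lhat := Lhat) hz
  have hne := eventually_det_Delta_ne_zero (Lhat := Lhat) hz
  have hprod : ∀ᶠ z in 𝓝[≠] lam₀, deltaCLM Lhat z * DeltaInv Lhat z = 1 := by
    filter_upwards [hne, (eventually_halfPlane hz).filter_mono nhdsWithin_le_nhds] with z h1 h2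
      using deltaCLM_comp_DeltaInv h2 h1
  have hneg : meromorphicOrderAt (DeltaInv Lhat) lam₀ < 0 := by
    -- If there were no pole, the limit of `Δ(z)⁻¹` would be a right inverse of `Δ(lam₀)`,
    -- contradicting `det Δ(lam₀) = 0`.
    by_contra! hge
    obtain ⟨M, hM⟩ := (tendsto_nhds_iff_meromorphicOrderAt_nonneg hmer).2 hge
    have hlim := ((analyticAt_deltaCLM (Lhat := Lhat) hz).continuousAt.tendsto.mono_left
      (nhdsWithin_le_nhds (s := {lam₀}ᶜ))).mul hM
    have hM1 : deltaCLM Lhat lam₀ * M = 1 :=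
      tendsto_nhds_unique hlim (tendsto_const_nhds.congr' (hprod.mono fun z h => h.symm))
    refine det_Delta_ne_zero_of_isUnit (Lhat := Lhat) hz ?_ hdet
    have hsurj : Function.Surjective (deltaCLM Lhat lam₀) := fun c =>
      ⟨M c, congrArg (fun T => T c) hM1⟩
    rw [ContinuousLinearMap.isUnit_iff_bijective]
    exact ⟨(LinearMap.injective_iff_surjective
      (f := (deltaCLM Lhat lam₀ : Cn n →ₗ[ℂ] Cn n))).2 hsurj, hsurj⟩
  obtain ⟨m, hm⟩ := WithTop.ne_top_iff_exists.1 hneg.ne_top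
  have hm0 : m < 0 := by
    rw [← hm, ← WithTop.coe_zero, WithTop.coe_lt_coe] at hneg
    exact hneg
  obtain ⟨g, hg, hg0, hgz⟩ := (meromorphicOrderAt_eq_int_iff hmer).1 hm.symm
  have hk : (-((-m).toNat : ℤ)) = m := by omega
  refine ⟨(-m).toNat, g, by omega, hg, hg0, ?_, ?_⟩
  · rw [hk, hm]
  · rwa [hk]

/-! ### Laurent coefficients of the resolvent of `A + L` -/

variable (Lhat lam₀)

/-- `(z - lam₀)ᵏ` times the resolvent of `A + L`, when `g z = (z - lam₀)ᵏ Δ(z)⁻¹`. -/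
def resolventRegular (k : ℕ) (g : ℂ → Cn n →L[ℂ] Cn n) (z : ℂ) : State η n →L[ℂ] State η n :=
  (ContinuousLinearMap.inr ℂ (Cn n) (BUC η n)).comp
    ((expCLM η n z).comp ((g z).comp (bracketCLM Lhat z)) +
      (z - lam₀) ^ k • (integralCLM η n z).comp (ContinuousLinearMap.snd ℂ (Cn n) (BUC η n)))

variable {Lhat lam₀} {k : ℕ} {g : ℂ → Cn n →L[ℂ] Cn n}

theorem resolventRegular_apply {z : ℂ} (hz : -η < z.re) (x : State η n) :
    resolventRegular Lhat lam₀ k g z x =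
      (0, expBUC η z (g z (bracket Lhat x z)) + (z - lam₀) ^ k • expIntegral 0 z x.2) := by
  simp [resolventRegular, bracketCLM_apply hz, expCLM_apply hz, integralCLM_apply hz]

theorem analyticAt_resolventRegular (hz : -η < lam₀.re) (hg : AnalyticAt ℂ g lam₀) :
    AnalyticAt ℂ (resolventRegular Lhat lam₀ k g) lam₀ := by
  refine analyticAt_clm_comp analyticAt_const (AnalyticAt.add ?_ ?_)
  · exact analyticAt_clm_comp (analyticAt_expCLM hz)
      (analyticAt_clm_comp hg (analyticAt_bracketCLM hz))
  · exact AnalyticAt.fun_smul (by fun_prop)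
      (analyticAt_clm_comp (analyticAt_integralCLM hz) analyticAt_const)

theorem isResolventAt_resolventRegular (hz : -η < lam₀.re)
    (hf : ∀ᶠ z in 𝓝[≠] lam₀, DeltaInv Lhat z = (z - lam₀) ^ (-(k : ℤ)) • g z) :
    ∀ᶠ z in 𝓝[≠] lam₀, IsResolventAt (opA η n + opL Lhat) z
      ((z - lam₀) ^ (-(k : ℤ)) • resolventRegular Lhat lam₀ k g z) := by
  filter_upwards [hf, eventually_det_Delta_ne_zero (Lhat := Lhat) hz, self_mem_nhdsWithin,
    (eventually_halfPlane hz).filter_mono nhdsWithin_le_nhds] with z h1 h2 h3 h4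
  have hne' : z - lam₀ ≠ 0 := sub_ne_zero.2 h3
  convert isResolventAt_resolventFormula h4 h2 using 1
  refine ContinuousLinearMap.ext fun x => ?_
  rw [_root_.smul_apply, resolventRegular_apply h4, resolventFormula_apply h4, h1, Prod.smul_mk,
    smul_zero, smul_add, smul_smul, ← zpow_natCast, ← zpow_add₀ hne', neg_add_cancel, zpow_zero,
    one_smul, ← expBUC_smul h4]
  rfl

/-- On `(c, 0)` the bracket is `c` and the integral term is killed by `(z - lam₀)ᵏ` with `k ≥ 1`, so
evaluation at `θ = 0` returns `g(lam₀) c`. -/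
theorem resolventRegular_ne_zero (hz : -η < lam₀.re) (hk : 1 ≤ k) (hg : g lam₀ ≠ 0) :
    resolventRegular Lhat lam₀ k g lam₀ ≠ 0 := by
  intro h
  refine hg (ContinuousLinearMap.ext fun c => ?_)
  have h1 := congrArg (fun T => at0 (T ((c, 0) : State η n)).2) h
  simp only [resolventRegular_apply hz, sub_self, zero_pow (by omega : k ≠ 0), zero_smul,
    add_zero, expBUC_at0 hz] at h1
  have h2 : bracket Lhat ((c, 0) : State η n) lam₀ = c := by
    rw [← bracketCLM_apply hz]
    simp [bracketCLM]
  rw [h2] at h1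
  exact h1

theorem taylorCoeff_resolventRegular_fst (hz : -η < lam₀.re) (hg : AnalyticAt ℂ g lam₀)
    (x : State η n) (j : ℕ) :
    (taylorCoeff (resolventRegular Lhat lam₀ k g) lam₀ j x).1 = 0 := by
  have han := analyticAt_resolventRegular (Lhat := Lhat) (k := k) hz hg
  have h1 := taylorCoeff_clm (ContinuousLinearMap.fst ℂ (Cn n) (BUC η n))
    (analyticAt_clm_apply han (analyticAt_const (v := x))) j
  rw [taylorCoeff_clm_apply han] at h1
  refine h1.symm.trans (taylorCoeff_const_zero (z₀ := lam₀) (E := Cn n) j ▸ taylorCoeff_congr ?_ j)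
  filter_upwards [eventually_halfPlane hz] with z h2
  rw [resolventRegular_apply h2]
  rfl

/-- The integral term starts at order `k` and so does not reach order `k - 1`; what remains is the
Cauchy product of `g` with `L₀²`, evaluated at `θ`. -/
theorem taylorCoeff_resolventRegular_snd (hz : -η < lam₀.re) (hk : 1 ≤ k)
    (hg : AnalyticAt ℂ g lam₀) (x : State η n) (θ : Iic (0 : ℝ)) :
    (taylorCoeff (resolventRegular Lhat lam₀ k g) lam₀ (k - 1) x).2 θ =
      ∑ j ∈ Finset.range k, (j.factorial : ℂ)⁻¹ •
        taylorCoeff g lam₀ (k - 1 - j) (iteratedDeriv j (Ltwo Lhat x) lam₀ θ) := by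
  have han := analyticAt_resolventRegular (Lhat := Lhat) (k := k) hz hg
  have hL := analyticAt_Ltwo (Lhat := Lhat) x hz
  have hI := analyticAt_expIntegral_zero x.2 hz
  have hLθ : AnalyticAt ℂ (fun z => evalCLM η n θ (Ltwo Lhat x z)) lam₀ :=
    analyticAt_clm_apply analyticAt_const hL
  have hIθ : AnalyticAt ℂ (fun z => evalCLM η n θ (expIntegral 0 z x.2)) lam₀ :=
    analyticAt_clm_apply analyticAt_const hI
  have h1 := taylorCoeff_clm ((evalCLM η n θ).comp (ContinuousLinearMap.snd ℂ (Cn n) (BUC η n)))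
    (analyticAt_clm_apply han (analyticAt_const (v := x))) (k - 1)
  rw [taylorCoeff_clm_apply han] at h1
  refine h1.symm.trans ?_
  have hEq : (fun z => ((evalCLM η n θ).comp (ContinuousLinearMap.snd ℂ (Cn n) (BUC η n)))
      (resolventRegular Lhat lam₀ k g z x)) =ᶠ[𝓝 lam₀] fun z =>
        ContinuousLinearMap.id ℂ (Cn n →L[ℂ] Cn n) (g z) (evalCLM η n θ (Ltwo Lhat x z)) +
          (z - lam₀) ^ k • evalCLM η n θ (expIntegral 0 z x.2) := by
    filter_upwards [eventually_halfPlane hz] with z h2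
    rw [resolventRegular_apply h2]
    simp [Ltwo, expBUC_apply h2]
  rw [taylorCoeff_congr hEq, taylorCoeff_add (analyticAt_bilinear _ hg hLθ)
    (AnalyticAt.fun_smul (by fun_prop) hIθ), taylorCoeff_pow_smul hIθ, if_pos (by omega), add_zero,
    taylorCoeff_bilinear _ hg hLθ, Nat.sub_add_cancel hk]
  refine Finset.sum_congr rfl fun j _ => ?_
  rw [taylorCoeff_clm _ hL, ← map_smul]
  rfl

end DelayEq
end

open DelayEq in
theorem proposition5p4 (η : ℝ) (n : ℕ) (Lhat : BUC η n →L[ℂ] Cn n) (lam₀ : ℂ)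
    (hspec : lam₀ ∈ DelayEq.spectrum (opA η n + opL Lhat))
    (hre : -η < lam₀.re ∨
      essGrowthBound (partInClosure (opA η n + opL Lhat)) < (lam₀.re : EReal)) :
    -- `Δ` is defined near `lam₀`
    -η < lam₀.re ∧
    -- `lam₀` is isolated in the spectrum, and `Δ` is invertible near it
    (∀ᶠ z in 𝓝[≠] lam₀, z ∈ resolventSet (opA η n + opL Lhat) ∧ (Delta Lhat z).det ≠ 0) ∧
    ∃ (k₀ : ℕ) (B : ℤ → State η n →L[ℂ] State η n) (D : ℤ → Cn n →L[ℂ] Cn n),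
      1 ≤ k₀ ∧
      -- `lam₀` is a pole of order `k₀` of the resolvent of `A + L`
      HasLaurentExpansionAt (DelayEq.resolvent (opA η n + opL Lhat)) lam₀ k₀ B ∧ B (-k₀) ≠ 0 ∧
      -- and a pole of order `k₀` of `Δ⁻¹`
      HasLaurentExpansionAt (DeltaInv Lhat) lam₀ k₀ D ∧ D (-k₀) ≠ 0 ∧
      Tendsto (fun z => (z - lam₀) ^ k₀ • DeltaInv Lhat z) (𝓝[≠] lam₀) (𝓝 (D (-k₀))) ∧
      -- `k₀` is the only integer for which `(z - lam₀)ᵏ Δ(z)⁻¹` has a nonzero limit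
      (∀ k : ℤ, (∃ M : Cn n →L[ℂ] Cn n, M ≠ 0 ∧
        Tendsto (fun z => (z - lam₀) ^ k • DeltaInv Lhat z) (𝓝[≠] lam₀) (𝓝 M)) → k = k₀) ∧
      -- the coefficients `Δ₋ⱼ` as limits of derivatives
      (∀ j : ℕ, 1 ≤ j → j ≤ k₀ →
        Tendsto (fun z => ((k₀ - j).factorial : ℂ)⁻¹ •
            iteratedDeriv (k₀ - j) (fun w => (w - lam₀) ^ k₀ • DeltaInv Lhat w) z)
          (𝓝[≠] lam₀) (𝓝 (D (-j)))) ∧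
      -- `B₋₁` is a projector onto the generalized eigenspace
      (B (-1)).comp (B (-1)) = B (-1) ∧
      range (B (-1)) = generalizedEigenspace (opA η n + opL Lhat) lam₀ ∧
      -- the formula for the projector
      (∀ x : State η n, (B (-1) x).1 = 0 ∧ ∀ θ : Iic (0 : ℝ), (B (-1) x).2 θ =
        ∑ j ∈ Finset.range k₀,
          (j.factorial : ℂ)⁻¹ • D (-1 - j) (iteratedDeriv j (Ltwo Lhat x) lam₀ θ)) ∧
      -- the derivatives `L²ⱼ(z) = dʲ/dzʲ L²₀(z)`
      (∀ x : State η n,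
        DifferentiableOn ℂ (Ltwo Lhat x) {z | -η < z.re} ∧
        DifferentiableOn ℂ (bracket Lhat x) {z | -η < z.re} ∧
        ∀ z : ℂ, -η < z.re →
          (∀ (j : ℕ) (θ : Iic (0 : ℝ)), iteratedDeriv j (Ltwo Lhat x) z θ =
            ∑ k ∈ Finset.range (j + 1), ((j.choose k : ℂ) * ((θ : ℝ) : ℂ) ^ k *
              Complex.exp (z * (θ : ℝ))) • iteratedDeriv (j - k) (bracket Lhat x) z) ∧
          ∀ i : ℕ, 1 ≤ i → iteratedDeriv i (bracket Lhat x) z = Lhat (expIntegral i z x.2)) := by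
  have hz := neg_lt_re_of_mem_spectrum hspec hre
  obtain ⟨k₀, g, hk, hg, hg0, hord, hgz⟩ :=
    exists_pole_DeltaInv hz (det_Delta_eq_zero_of_mem_spectrum hspec hz)
  set G := resolventRegular Lhat lam₀ k₀ g
  have hG : AnalyticAt ℂ G lam₀ := analyticAt_resolventRegular hz hg
  have hR := isResolventAt_resolventRegular hz hgz
  have hG1 : laurentCoeff G lam₀ k₀ (-1) = taylorCoeff G lam₀ (k₀ - 1) :=
    laurentCoeff_neg_of_le (j := 1) hk
  have hmem := taylorCoeff_mem_generalizedEigenspace hG hR hk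
  have hfix := fun x hx => taylorCoeff_apply_of_mem_generalizedEigenspace (x := x) hG hR hk hx
  refine ⟨hz, ?_, k₀, laurentCoeff G lam₀ k₀, laurentCoeff g lam₀ k₀, hk, ?_, ?_, ?_, ?_, ?_, ?_,
    ?_, ?_, ?_, ?_, ?_⟩
  · filter_upwards [hR, eventually_det_Delta_ne_zero (Lhat := Lhat) hz] with z h1 h2
      using ⟨⟨_, h1⟩, h2⟩
  · exact hasLaurentExpansionAt_of_eventually_eq hG (hR.mono fun z h => h.resolvent_eq)
  · rw [laurentCoeff_neg_order]
    exact resolventRegular_ne_zero hz hk hg0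
  · exact hasLaurentExpansionAt_of_eventually_eq hg hgz
  · rwa [laurentCoeff_neg_order]
  · rw [laurentCoeff_neg_order]
    have hEq := eventuallyEq_pow_smul (f := DeltaInv Lhat) (g := g) hgz
    exact (hg.continuousAt.tendsto.mono_left nhdsWithin_le_nhds).congr' hEq.symm
  · rintro k ⟨M, hM, hlim⟩
    exact eq_of_tendsto_zpow_smul (meromorphicAt_DeltaInv hz) hord hM hlim
  · intro j _ hj
    rw [laurentCoeff_neg_of_le hj]
    exact tendsto_iteratedDeriv_pow_smul hg hgz (k₀ - j)
  -- Idempotence needs no contour integral: values of `B₋₁` lie in the generalized eigenspace, on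
  -- which it acts as the identity.
  · rw [hG1]
    exact ContinuousLinearMap.ext fun x => hfix _ (hmem x)
  · rw [hG1]
    exact Subset.antisymm (range_subset_iff.2 hmem) fun x hx => ⟨x, hfix x hx⟩
  · intro x
    rw [hG1]
    refine ⟨taylorCoeff_resolventRegular_fst hz hg x _, fun θ => ?_⟩
    rw [taylorCoeff_resolventRegular_snd hz hk hg]
    refine Finset.sum_congr rfl fun j hj => ?_
    have hj' : 1 + j ≤ k₀ := by have := Finset.mem_range.1 hj; omega
    have e : (-1 - j : ℤ) = -((1 + j : ℕ) : ℤ) := by push_cast; ring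
    rw [e, laurentCoeff_neg_of_le hj', Nat.sub_sub]
  · intro x
    exact ⟨fun z h => (analyticAt_Ltwo x h).differentiableAt.differentiableWithinAt,
      fun z h => (analyticAt_bracket x h).differentiableAt.differentiableWithinAt,
      fun z h => ⟨fun j θ => iteratedDeriv_Ltwo_apply x h j θ,
        fun i hi => iteratedDeriv_bracket x h hi⟩⟩
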